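/- All groups are finite; $\pi(G)$ denotes the set of prime divisors of $|G|$. A graph $\Gamma$ is a set of vertices $V(\Gamma)$ together with a set $E(\Gamma)$ of ordered pairs of vertices (loops allowed); $\Gamma_1\subseteq\Gamma_2$ means $V(\Gamma_1)\subseteq V(\Gamma_2)$ and $E(\Gamma_1)\subseteq E(\Gamma_2)$, and unions of graphs are taken on vertices and on edges. For a group $G$ define three graphs with vertex set $\pi(G)$: - the Hawkes graph $\Gamma_H(G)$: $(p,q)$ is an edge iff $q\in\pi(G/\mathrm{O}_{p',p}(G))$, where $\mathrm{O}_{p',p}(G)/\mathrm{O}_{p'}(G)=\mathrm{O}_p(G/\mathrm{O}_{p'}(G))$; - the Sylow graph $\Gamma_s(G)$: $(p,q)$ is an edge iff $q\in\pi(N_G(P)/PC_G(P))$ for some Sylow $p$-subgroup $P$ of $G$; - the $N$-critical graph $\Gamma_{Nc}(G)$: $(p,q)$ is an edge iff $G$ has a subgroup $S$ which is a Schmidt $(p,q)$-group, i.e. $S$ is not nilpotent, all proper subgroups of $S$ are nilpotent, $\pi(S)=\{p,q\}$ and $S$ has a normal Sylow $p$-subgroup. For a class $\mathfrak{X}$ of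 groups (closed under isomorphism) put $\Gamma(\mathfrak{X})=\bigcup_{X\in\mathfrak{X}}\Gamma(X)$, and let $\Gamma(\mathfrak{X})_{|G}$ be the subgraph of $\Gamma(\mathfrak{X})$ induced on the vertices lying in $\pi(G)$. A formation is a class of groups closed under homomorphic images and such that $X/M, X/N\in\mathfrak{F}$ implies $X/(M\cap N)\in\mathfrak{F}$ for normal subgroups $M,N$ of $X$; it is hereditary if it is closed under subgroups. A chief factor $H/K$ of $G$ is $\mathfrak{X}$-central if $(H/K)\rtimes(G/C_G(H/K))\in\mathfrak{X}$ (conjugation action), and $\mathrm{Z}_{\mathfrak{X}}(G)$ is the greatest normal subgroup of $G$ such that every chief factor of $G$ below it is $\mathfrak{X}$-central. **Theorem.** Let $\mathfrak{F}$ be a hereditary formation containing all nilpotent groups, and let $\Gamma\in\{\Gamma_s,\Gamma_{Nc},\Gamma_H\}$. Let $G$ be a group with subgroups $G_1,\dots,G_n$ such that $G=G_1\cdots G_n$, $G_iG_j$ is a subgroup of $G$ for all $i,j\in\{1,\dots,n\}$, and $$\Big[G_i,\prod_{j=1,\,j\neq i}^n G_j\Big]\leq \mathrm{Z}_{\mathfrak{F}}(G)\quad\text{for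 every } i\in\{1,\dots,n\}.$$ Then $$\Gamma(G)\subseteq\bigcup_{i=1}^n\Gamma(G_i)\cup\Gamma(\mathfrak{F})_{|G}.$$ -/

import Mathlib

open scoped Pointwise

universe u

/-- A directed graph on natural numbers: a set of vertices and a set of edges, the edges being
ordered pairs of vertices (loops are allowed). -/
@[ext]
structure DirGraph where
  verts : Set ℕ
  edges : Set (ℕ × ℕ)
  edges_subset : ∀ e ∈ edges, e.1 ∈ verts ∧ e.2 ∈ verts

namespace DirGraph

/-- `A` is a subgraph of `B`. -/
def IsSubgraph (A B : DirGraph) : Prop :=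
  A.verts ⊆ B.verts ∧ A.edges ⊆ B.edges

/-- The union of two graphs. -/
def union (A B : DirGraph) : DirGraph where
  verts := A.verts ∪ B.verts
  edges := A.edges ∪ B.edges
  edges_subset := by
    rintro e (h | h)
    · exact ⟨Or.inl (A.edges_subset e h).1, Or.inl (A.edges_subset e h).2⟩
    · exact ⟨Or.inr (B.edges_subset e h).1, Or.inr (B.edges_subset e h).2⟩

/-- The union of a family of graphs. -/
def iUnion {ι : Type*} (A : ι → DirGraph) : DirGraph where
  verts := ⋃ i, (A i).verts
  edges := ⋃ i, (A i).edges
  edges_subset := by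
    intro e he
    obtain ⟨i, hi⟩ := Set.mem_iUnion.1 he
    exact ⟨Set.mem_iUnion.2 ⟨i, ((A i).edges_subset e hi).1⟩,
      Set.mem_iUnion.2 ⟨i, ((A i).edges_subset e hi).2⟩⟩

/-- The induced subgraph on the vertices lying in `S`. -/
def restrict (A : DirGraph) (S : Set ℕ) : DirGraph where
  verts := A.verts ∩ S
  edges := {e ∈ A.edges | e.1 ∈ S ∧ e.2 ∈ S}
  edges_subset := fun e he =>
    ⟨⟨(A.edges_subset e he.1).1, he.2.1⟩, ⟨(A.edges_subset e he.1).2, he.2.2⟩⟩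

end DirGraph

/-- `π(X)`: the set of prime divisors of the cardinality of `X`. -/
def primeDivisors (X : Type*) : Set ℕ := {p | p.Prime ∧ p ∣ Nat.card X}

/-- `O_π(G)`: the greatest normal `π`-subgroup of a finite group `G`, as the join of all
normal `π`-subgroups. -/
def piCore (π : Set ℕ) (G : Type*) [Group G] : Subgroup G :=
  sSup {N : Subgroup G | N.Normal ∧ primeDivisors N ⊆ π}

instance piCore_normal (π : Set ℕ) (G : Type*) [Group G] : (piCore π G).Normal :=
  Subgroup.sSup_normal _ fun _ hN => hN.1

/-- `O_{p',p}(G)`: the preimage in `G` of `O_p(G / O_{p'}(G))`. -/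
def pNilpotentRadical (p : ℕ) (G : Type*) [Group G] : Subgroup G :=
  (piCore {p} (G ⧸ piCore {p}ᶜ G)).comap (QuotientGroup.mk' (piCore {p}ᶜ G))

/-- The Hawkes graph: `(p, q)` is an edge when `q ∈ π(G / O_{p',p}(G))`. -/
def hawkesGraph (G : Type u) [Group G] : DirGraph where
  verts := primeDivisors G
  edges := {e | (e.1 ∈ primeDivisors G ∧ e.2 ∈ primeDivisors G) ∧
    e.2 ∈ primeDivisors (G ⧸ pNilpotentRadical e.1 G)}
  edges_subset := fun _ he => he.1

/-- The Sylow graph: `(p, q)` is an edge when `q ∈ π(N_G(P) / P C_G(P))` for some Sylow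
`p`-subgroup `P` of `G`. Note that `P C_G(P) = P ⊔ C_G(P)`. -/
def sylowGraph (G : Type u) [Group G] : DirGraph where
  verts := primeDivisors G
  edges := {e | (e.1 ∈ primeDivisors G ∧ e.2 ∈ primeDivisors G) ∧
    ∃ P : Sylow e.1 G, e.2 ∈ primeDivisors
      (Subgroup.normalizer (P : Set G) ⧸
        ((P : Subgroup G) ⊔ Subgroup.centralizer (P : Set G)).subgroupOf
          (Subgroup.normalizer (P : Set G)))}
  edges_subset := fun _ he => he.1

/-- A Schmidt `(p, q)`-group: a non-nilpotent group all of whose proper subgroups are nilpotent,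
with `π(S) = {p, q}` and a normal Sylow `p`-subgroup. -/
def IsSchmidtGroup (p q : ℕ) (S : Type*) [Group S] : Prop :=
  ¬ Group.IsNilpotent S ∧ (∀ H : Subgroup S, H ≠ ⊤ → Group.IsNilpotent H) ∧
    primeDivisors S = {p, q} ∧ ∃ P : Sylow p S, (P : Subgroup S).Normal

/-- The `N`-critical graph: `(p, q)` is an edge when `G` has a Schmidt `(p, q)`-subgroup. -/
def nCriticalGraph (G : Type u) [Group G] : DirGraph where
  verts := primeDivisors G
  edges := {e | (e.1 ∈ primeDivisors G ∧ e.2 ∈ primeDivisors G) ∧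
    ∃ S : Subgroup G, IsSchmidtGroup e.1 e.2 S}
  edges_subset := fun _ he => he.1

/-- A class of finite groups, closed under isomorphism. -/
structure GroupClass where
  Mem : (X : Type u) → [Group X] → Prop
  finite_of_mem : ∀ (X : Type u) [Group X], Mem X → Finite X
  mem_of_mulEquiv : ∀ (X Y : Type u) [Group X] [Group Y], (X ≃* Y) → Mem X → Mem Y

namespace GroupClass

/-- A formation: a class closed under homomorphic images and such that `X/(M ∩ N)` belongs to it
whenever `X/M` and `X/N` do. -/
structure IsFormation (F : GroupClass.{u}) : Prop where
  quotient_mem : ∀ (X : Type u) [Group X] (N : Subgroup X) [N.Normal], F.Mem X → F.Mem (X ⧸ N)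
  quotient_inf_mem : ∀ (X : Type u) [Group X] [Finite X] (M N : Subgroup X)
    [M.Normal] [N.Normal], F.Mem (X ⧸ M) → F.Mem (X ⧸ N) → F.Mem (X ⧸ (M ⊓ N))

/-- A class is hereditary when it is closed under subgroups. -/
def IsHereditary (F : GroupClass.{u}) : Prop :=
  ∀ (X : Type u) [Group X] (H : Subgroup X), F.Mem X → F.Mem H

/-- The class contains all finite nilpotent groups. -/
def ContainsNilpotent (F : GroupClass.{u}) : Prop :=
  ∀ (X : Type u) [Group X] [Finite X], Group.IsNilpotent X → F.Mem X

/-- `Γ(𝔛)`: the union of the graphs `Γ(X)` over all `X ∈ 𝔛`. -/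
def graph (Γ : (X : Type u) → [Group X] → DirGraph) (F : GroupClass.{u}) : DirGraph where
  verts := {p | ∃ (X : Type u) (_ : Group X), F.Mem X ∧ p ∈ (Γ X).verts}
  edges := {e | ∃ (X : Type u) (_ : Group X), F.Mem X ∧ e ∈ (Γ X).edges}
  edges_subset := by
    rintro e ⟨X, i, hX, he⟩
    exact ⟨⟨X, i, hX, ((Γ X).edges_subset e he).1⟩, ⟨X, i, hX, ((Γ X).edges_subset e he).2⟩⟩

end GroupClass

section Hypercenter

variable {G : Type u} [Group G]

/-- `H/K` is a chief factor of `G`. -/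
def IsChiefFactor (H K : Subgroup G) : Prop :=
  H.Normal ∧ K.Normal ∧ K < H ∧ ∀ L : Subgroup G, L.Normal → K ≤ L → L ≤ H → L = K ∨ L = H

/-- The factor `H/K` (for `K ≤ H`), as a subgroup of `G/K`. -/
abbrev factor (H K : Subgroup G) [K.Normal] : Subgroup (G ⧸ K) :=
  H.map (QuotientGroup.mk' K)

instance factor_normal (H K : Subgroup G) [H.Normal] [K.Normal] : (factor H K).Normal :=
  Subgroup.Normal.map inferInstance _ (QuotientGroup.mk'_surjective K)

/-- The action of `G` on `H/K` by conjugation. Its kernel is `C_G(H/K)`. -/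
def factorAction (H K : Subgroup G) [H.Normal] [K.Normal] : G →* MulAut (factor H K) :=
  (MulAut.conjNormal (H := factor H K)).comp (QuotientGroup.mk' K)

/-- `H/K` is `𝔛`-central in `G`: the semidirect product `(H/K) ⋊ (G/C_G(H/K))` belongs to `𝔛`. -/
def IsCentralFactor (F : GroupClass.{u}) (H K : Subgroup G) [H.Normal] [K.Normal] : Prop :=
  F.Mem (SemidirectProduct (factor H K) (G ⧸ (factorAction H K).ker)
    (QuotientGroup.kerLift (factorAction H K)))

/-- The normal subgroup `N` is `𝔛`-hypercentral: every chief factor of `G` below `N` is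
`𝔛`-central. -/
def IsHypercentral (F : GroupClass.{u}) (N : Subgroup G) : Prop :=
  N.Normal ∧ ∀ (H K : Subgroup G) [H.Normal] [K.Normal],
    IsChiefFactor H K → H ≤ N → IsCentralFactor F H K

variable (G) in
/-- The `𝔛`-hypercenter `Z_𝔛(G)`: the greatest `𝔛`-hypercentral normal subgroup of a finite group
`G`, as the join of all of them. -/
def hypercenter (F : GroupClass.{u}) : Subgroup G :=
  sSup {N : Subgroup G | IsHypercentral F N}

/-- The setwise product of the subgroups `A j` for `j` running through the list `l` in order. -/
def listProduct {n : ℕ} (A : Fin n → Subgroup G) (l : List (Fin n)) : Set G :=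
  (l.map fun j => (A j : Set G)).prod

/-- `G` is the product of the subgroups `A 0, …, A (n - 1)` with `𝔉`-hypercentral condition for
commutators. -/
structure IsHypercentralProduct (F : GroupClass.{u}) {n : ℕ} (A : Fin n → Subgroup G) : Prop where
  product_eq : listProduct A (List.finRange n) = Set.univ
  permutable : ∀ i j, ∃ B : Subgroup G, (B : Set G) = (A i : Set G) * (A j : Set G)
  commutator_le : ∀ i,
    ⁅A i, Subgroup.closure (listProduct A ((List.finRange n).filter (· ≠ i)))⁆ ≤ hypercenter G F

end Hypercenter

/-! Vertices cost nothing: a Sylow subgroup is nilpotent, so it lies in F. For edges, choose a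
normal M containing Z_F(G) and reached from 1 by one series of F-central chief factors
(`exists_centralSeries_ge_hypercenter`). The images of the G_i in G/M commute elementwise, so G/M is
an image of the direct product of the G_i. It remains to follow an edge through M, through a
surjection and through a direct product.

For the Sylow and N-critical graphs, an edge (p, q) means that p ≠ q and that some q-element x
normalizes but does not centralize a p-subgroup R (a Sylow subgroup for the Sylow graph). If x acts
trivially on R modulo M and on the trace of R in each chief factor H/K of the series, then
coprimeness forces x to centralize R (`mem_centralizer_of_centralSeries`). A nontrivial action on a
trace shows up in (H/K) ⋊ (G/C_G(H/K)), a member of F, and heredity turns it into an edge of F.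
Otherwise the action survives in G/M, lifts to the direct product
(`exists_hasQAction_of_surjective`) and is nontrivial in some coordinate.

For the Hawkes graph, absence of (p, q) means that every element has a power of exponent prime to q
in O_{p',p}. This passes to products and images, hence to G/M. Descending the series, the preimage
of O_{p',p}(G/M) is intersected with C_G(H/K) whenever p divides |H/K|. Such a centralizer is large
enough because O_{p',p} centralizes minimal normal subgroups of order divisible by p
(`powInto_ker_factorAction`). The final intersection is p-nilpotent. -/

/-! ### Powers and coprime exponents. -/

section Powers

variable {G : Type*} [Group G]

/-- There is an exponent `s` such that every `s`-th power is a `q`-element and raising to the power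
`s` fixes every `q`-element. -/
theorem exists_pow_projection (G : Type*) [Group G] [Finite G] {q : ℕ} (hq : q.Prime) :
    ∃ s : ℕ, (∀ g : G, ∃ k, (g ^ s) ^ q ^ k = 1) ∧ ∀ g : G, (∃ k, g ^ q ^ k = 1) → g ^ s = g := by
  have hn : Nat.card G ≠ 0 := Nat.card_pos.ne'
  set a := (Nat.card G).factorization q
  set b := Nat.card G / q ^ a
  have hab : q ^ a * b = Nat.card G := Nat.ordProj_mul_ordCompl_eq_self _ _
  have hcop : Nat.Coprime (q ^ a) b := Nat.Coprime.pow_left _ (Nat.coprime_ordCompl hq hn)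
  -- With s ≡ 1 modulo the q-part of |G| and s ≡ 0 modulo its q'-part, `g ^ s` is the q-part of g.
  obtain ⟨s, hs1, hs0⟩ := Nat.chineseRemainder hcop 1 0
  refine ⟨s, fun g => ⟨a, ?_⟩, fun g ⟨k, hk⟩ => ?_⟩
  · obtain ⟨c, hc⟩ := (Nat.modEq_zero_iff_dvd.1 hs0)
    rw [← pow_mul, hc, show b * c * q ^ a = Nat.card G * c by rw [← hab]; ring, pow_mul,
      pow_card_eq_one', one_pow]
  · have h1 : orderOf g ∣ q ^ a := by
      obtain ⟨j, -, hj⟩ := (Nat.dvd_prime_pow hq).1 (orderOf_dvd_of_pow_eq_one hk)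
      rw [hj]
      have h2 : q ^ j ∣ q ^ a * b := by rw [hab, ← hj]; exact orderOf_dvd_natCard g
      refine Nat.Coprime.dvd_of_dvd_mul_right ?_ h2
      exact Nat.Coprime.pow_left _ (Nat.coprime_ordCompl hq hn)
    have h3 : s ≡ 1 [MOD orderOf g] := hs1.of_dvd h1
    simpa using pow_eq_pow_iff_modEq.2 h3

theorem mem_of_pow_mem_of_coprime {K : Subgroup G} {g : G} {m n : ℕ} (h : m.Coprime n)
    (hm : g ^ m ∈ K) (hn : g ^ n ∈ K) : g ∈ K := by
  have h1 : g = (g ^ m) ^ (m.gcdA n) * (g ^ n) ^ (m.gcdB n) := by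
    rw [← zpow_natCast, ← zpow_natCast, ← zpow_mul, ← zpow_mul, ← zpow_add,
      ← Nat.gcd_eq_gcd_ab, h.gcd_eq_one]
    simp
  rw [h1]
  exact mul_mem (zpow_mem hm _) (zpow_mem hn _)

end Powers

/-! ### Actions of q-elements and the edges of the Sylow graph. -/

section QAction

variable {G : Type*} [Group G]

/-- Some `q`-element of the group normalizes but does not centralize `R`. -/
def HasQAction (q : ℕ) (R : Subgroup G) : Prop :=
  ∃ x ∈ Subgroup.normalizer (R : Set G), (∃ k, x ^ q ^ k = 1) ∧
    x ∉ Subgroup.centralizer (R : Set G)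

theorem HasQAction.prime_dvd_card [Finite G] {q : ℕ} (hq : q.Prime) {R : Subgroup G}
    (h : HasQAction q R) : q ∣ Nat.card G := by
  obtain ⟨x, -, ⟨k, hk⟩, hx⟩ := h
  obtain ⟨j, -, hj⟩ := (Nat.dvd_prime_pow hq).1 (orderOf_dvd_of_pow_eq_one hk)
  have hj0 : j ≠ 0 := by
    rintro rfl
    rw [pow_zero, orderOf_eq_one_iff] at hj
    exact hx (hj ▸ one_mem _)
  exact ((dvd_pow_self q hj0).trans hj.symm.dvd).trans (orderOf_dvd_natCard x)

theorem HasQAction.prime_dvd_card_left [Finite G] {p q : ℕ} (hp : p.Prime) {R : Subgroup G}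
    (hR : IsPGroup p R) (h : HasQAction q R) : p ∣ Nat.card G := by
  have := Fact.mk hp
  obtain ⟨x, -, -, hx⟩ := h
  refine (hR.card_eq_or_dvd.resolve_left fun h1 => hx ?_).trans (Subgroup.card_subgroup_dvd_card R)
  rw [Subgroup.card_eq_one.1 h1]
  simp [Subgroup.mem_centralizer_iff]

/-- This drives the coprime action argument: if also x ^ n = 1, then c ^ n = 1, so the order of c is
controlled by that of x. -/
theorem pow_conj_of_commutator {x r c : G} (h : x * r * x⁻¹ = c * r) (hc : x * c * x⁻¹ = c)
    (n : ℕ) : x ^ n * r * (x ^ n)⁻¹ = c ^ n * r := by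
  have hxc : Commute x c := mul_inv_eq_iff_eq_mul.1 hc
  induction n with
  | zero => simp
  | succ n ih =>
    calc x ^ (n + 1) * r * (x ^ (n + 1))⁻¹ = x ^ n * (x * r * x⁻¹) * (x ^ n)⁻¹ := by
          rw [pow_succ]; group
      _ = (x ^ n * c) * r * (x ^ n)⁻¹ := by rw [h]; group
      _ = c * (x ^ n * r * (x ^ n)⁻¹) := by rw [(hxc.pow_left n).eq]; group
      _ = c ^ (n + 1) * r := by rw [ih, pow_succ']; group

theorem normalizer_le_normalizer_centralizer (R : Subgroup G) :
    Subgroup.normalizer (R : Set G) ≤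
      Subgroup.normalizer (Subgroup.centralizer (R : Set G) : Set G) := by
  refine Subgroup.le_normalizer_iff.2 fun x hx c hc => Subgroup.mem_centralizer_iff.2 fun r hr => ?_
  have h := Subgroup.mem_centralizer_iff.1 hc _ ((Subgroup.mem_normalizer_iff''.1 hx r).1 hr)
  calc r * (x * c * x⁻¹) = x * ((x⁻¹ * r * x) * c) * x⁻¹ := by group
    _ = x * (c * (x⁻¹ * r * x)) * x⁻¹ := by rw [h]
    _ = x * c * x⁻¹ * r := by group

/-- Sylow graph edges through `q`-elements acting on a Sylow `p`-subgroup. -/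
theorem mem_sylowGraph_edges_iff {G : Type u} [Group G] [Finite G] {p q : ℕ} :
    (p, q) ∈ (sylowGraph G).edges ↔
      p.Prime ∧ q.Prime ∧ p ≠ q ∧ ∃ P : Sylow p G, HasQAction q (P : Subgroup G) := by
  constructor
  · rintro ⟨⟨⟨hp, -⟩, -⟩, P, hq, hdvd⟩
    have := Fact.mk hp
    have := Fact.mk hq
    change q ∣ ((P : Subgroup G) ⊔ Subgroup.centralizer (P : Set G)).relIndex
          (Subgroup.normalizer (P : Set G)) at hdvd
    refine ⟨hp, hq, ?_, P, ?_⟩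
    · rintro rfl
      refine P.not_dvd_index ((hdvd.trans ?_))
      refine (Subgroup.relIndex_dvd_of_le_left _ le_sup_left).trans ?_
      exact Subgroup.relIndex_dvd_index_of_le Subgroup.le_normalizer
    · by_contra hcon
      let Q : Sylow q (Subgroup.normalizer (P : Set G)) := default
      -- Without a nontrivial action, the Sylow q-subgroup Q of N_G(P) lies in P C_G(P), whose index
      -- in N_G(P) is then prime to q.
      refine Q.not_dvd_index (hdvd.trans ?_)
      refine Subgroup.index_dvd_of_le (fun x hx => ?_)
      by_contra hx'
      refine hcon ⟨x, x.2, ?_, fun h => hx' ?_⟩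
      · obtain ⟨k, hk⟩ := Q.2 ⟨x, hx⟩
        exact ⟨k, by simpa [Subtype.ext_iff] using hk⟩
      · exact (le_sup_right : _ ≤ (P : Subgroup G) ⊔ _) h
  · rintro ⟨hp, hq, hpq, P, hact⟩
    have := Fact.mk hp
    refine ⟨⟨⟨hp, hact.prime_dvd_card_left hp P.2⟩, hq, hact.prime_dvd_card hq⟩, P, hq, ?_⟩
    obtain ⟨x, hxN, ⟨k, hk⟩, hxC⟩ := hact
    change q ∣ ((P : Subgroup G) ⊔ Subgroup.centralizer (P : Set G)).relIndex
          (Subgroup.normalizer (P : Set G))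
    by_contra hdvd
    set N := Subgroup.normalizer (P : Set G) with hN
    set C := Subgroup.centralizer (P : Set G) with hC
    have hnC : N ≤ Subgroup.normalizer (C : Set G) := normalizer_le_normalizer_centralizer _
    have hle : (P : Subgroup G) ⊔ C ≤ N :=
      sup_le Subgroup.le_normalizer (Subgroup.centralizer_le_normalizer _)
    have hnorm : ((P : Subgroup G) ⊔ C).subgroupOf N |>.Normal := by
      rw [Subgroup.normal_subgroupOf_iff_le_normalizer hle]
      exact (le_inf le_rfl hnC).trans (Subgroup.normalizer_inf_normalizer_le_normalizer_sup _ _)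
    have hxPC : x ∈ (P : Subgroup G) ⊔ C := by
      have h1 : (⟨x, hxN⟩ : N) ∈ ((P : Subgroup G) ⊔ C).subgroupOf N := by
        refine mem_of_pow_mem_of_coprime (m := q ^ k) (n := ((P : Subgroup G) ⊔ C).relIndex N)
          (Nat.Coprime.pow_left _ ((Nat.Prime.coprime_iff_not_dvd hq).2 hdvd)) ?_ ?_
        · rw [show (⟨x, hxN⟩ : N) ^ q ^ k = 1 from Subtype.ext hk]; exact one_mem _
        · exact Subgroup.pow_index_mem _ _
      exact h1
    rw [← SetLike.mem_coe, Subgroup.coe_mul_of_left_le_normalizer_right _ _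
      (Subgroup.le_normalizer.trans hnC)] at hxPC
    obtain ⟨u, hu, c, hc, rfl⟩ := Set.mem_mul.1 hxPC
    have huc : Commute u c := hc u hu
    obtain ⟨j, hj⟩ := P.2 ⟨u, hu⟩
    -- Since u and c commute and u is a p-element, a p-power of the q-element u c is a power of c,
    -- so u c itself centralizes P.
    refine hxC (mem_of_pow_mem_of_coprime (m := q ^ k) (n := p ^ j)
      (Nat.Coprime.pow _ _ ((Nat.coprime_primes hq hp).2 hpq.symm)) (hk ▸ one_mem _) ?_)
    have hj' : u ^ p ^ j = 1 := by simpa [Subtype.ext_iff] using hj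
    rw [huc.mul_pow, hj', one_mul]
    exact pow_mem hc _

end QAction

/-! ### Schmidt subgroups and the edges of the N-critical graph. -/

section Schmidt

theorem isPGroup_of_primeDivisors_subset {p : ℕ} {V : Type*} [Group V] [Finite V]
    (h : primeDivisors V ⊆ {p}) : IsPGroup p V :=
  IsPGroup.of_card (n := (Nat.card V).primeFactorsList.length)
    (Nat.eq_prime_pow_of_unique_prime_dvd Nat.card_pos.ne' fun hd hdS => h ⟨hd, hdS⟩)

theorem isNilpotent_of_primeDivisors_subset {p : ℕ} (hp : p.Prime) {S : Type*} [Group S] [Finite S]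
    (h : primeDivisors S ⊆ {p}) : Group.IsNilpotent S :=
  have := Fact.mk hp
  (isPGroup_of_primeDivisors_subset h).isNilpotent

theorem IsSchmidtGroup.ne {p q : ℕ} {S : Type*} [Group S] [Finite S] (h : IsSchmidtGroup p q S) :
    p ≠ q := by
  rintro rfl
  obtain ⟨hn, -, hpi, -⟩ := h
  exact hn (isNilpotent_of_primeDivisors_subset (hpi.ge (Or.inl rfl)).1 (by simp [hpi]))

/-- If all q-elements centralized the normal Sylow p-subgroup P, the normalizer of a Sylow
q-subgroup R would contain both P and R, hence be everything. All Sylow subgroups would be normal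
and S nilpotent. -/
theorem IsSchmidtGroup.exists_hasQAction {p q : ℕ} {S : Type*} [Group S] [Finite S]
    (h : IsSchmidtGroup p q S) : ∃ P : Subgroup S, IsPGroup p P ∧ HasQAction q P := by
  have hpq := h.ne
  obtain ⟨hn, -, hpi, P, hP⟩ := h
  have hp : p.Prime := (hpi.ge (Or.inl rfl)).1
  have hq : q.Prime := (hpi.ge (Or.inr rfl)).1
  have := Fact.mk hp
  have := Fact.mk hq
  refine ⟨P, P.2, ?_⟩
  by_contra hcon
  refine hn ((Group.isNilpotent_of_finite_tfae.out 0 3).2 fun r hr R => ?_)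
  have := Fact.mk hr.out
  by_cases hrS : r ∣ Nat.card S
  · have hrpq : r ∈ ({p, q} : Set ℕ) := hpi ▸ ⟨hr.out, hrS⟩
    rcases hrpq with h | h
    · have := Sylow.unique_of_normal P hP
      subst h
      rwa [Subsingleton.elim R P]
    · obtain rfl := Set.mem_singleton_iff.1 h
      have hPR : (P : Subgroup S) ≤ Subgroup.centralizer (R : Set S) := by
        suffices h : (R : Subgroup S) ≤ Subgroup.centralizer (P : Set S) from
          Subgroup.le_centralizer_iff.1 h
        intro x hx
        by_contra hxC
        refine hcon ⟨x, by rw [Subgroup.normalizer_eq_top]; trivial, ?_, hxC⟩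
        obtain ⟨k, hk⟩ := R.2 ⟨x, hx⟩
        exact ⟨k, by simpa [Subtype.ext_iff] using hk⟩
      rw [← Subgroup.normalizer_eq_top_iff, ← Subgroup.index_eq_one]
      by_contra hi
      obtain ⟨d, hd, hdi⟩ := Nat.exists_prime_and_dvd hi
      have hdS : d ∈ ({p, r} : Set ℕ) := hpi ▸ ⟨hd, hdi.trans (Subgroup.index_dvd_card _)⟩
      rcases hdS with h | h
      · rw [h] at hdi
        exact P.not_dvd_index (hdi.trans (Subgroup.index_dvd_of_le
          (hPR.trans (Subgroup.centralizer_le_normalizer _))))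
      · rw [Set.mem_singleton_iff.1 h] at hdi
        exact R.not_dvd_index (hdi.trans (Subgroup.index_dvd_of_le Subgroup.le_normalizer))
  · have : (R : Subgroup S) = ⊥ := by
      rw [← Subgroup.card_eq_one]
      exact (R.2.card_eq_or_dvd).resolve_right fun h =>
        hrS (h.trans (Subgroup.card_subgroup_dvd_card _))
    rw [this]
    infer_instance

/-- In a finite nilpotent group elements of coprime prime power orders commute. -/
theorem commute_of_isNilpotent {G : Type*} [Group G] [Finite G] [Group.IsNilpotent G] {p q : ℕ}
    (hp : p.Prime) (hq : q.Prime) (hpq : p ≠ q) {x y : G} {j k : ℕ} (hx : x ^ p ^ j = 1)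
    (hy : y ^ q ^ k = 1) : Commute x y := by
  have := Fact.mk hp
  have := Fact.mk hq
  have key : ∀ {r : ℕ} [Fact r.Prime] {z : G} {i : ℕ}, z ^ r ^ i = 1 → ∃ R : Sylow r G, z ∈ R := by
    intro r _ z i hz
    have hz' : IsPGroup r (Subgroup.zpowers z) := by
      obtain ⟨m, -, hm⟩ := (Nat.dvd_prime_pow Fact.out).1 (orderOf_dvd_of_pow_eq_one hz)
      exact IsPGroup.of_card (n := m) (by rw [Nat.card_zpowers, hm])
    obtain ⟨R, hR⟩ := hz'.exists_le_sylow
    exact ⟨R, hR (Subgroup.mem_zpowers z)⟩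
  obtain ⟨P, hP⟩ := key hx
  obtain ⟨Q, hQ⟩ := key hy
  exact Subgroup.commute_of_normal_of_disjoint _ _ inferInstance inferInstance
    (IsPGroup.disjoint_of_ne p q hpq _ _ P.2 Q.2) x y hP hQ

variable {G : Type*} [Group G]

theorem relIndex_sup_zpowers {q k : ℕ} (hq : q.Prime) {R : Subgroup G} {x : G}
    (hx : x ∈ Subgroup.normalizer (R : Set G)) (hxk : x ^ q ^ k = 1) :
    (R.subgroupOf (R ⊔ Subgroup.zpowers x)).Normal ∧
      ∃ m, R.relIndex (R ⊔ Subgroup.zpowers x) = q ^ m := by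
  have hle : Subgroup.zpowers x ≤ Subgroup.normalizer (R : Set G) := by simpa using hx
  have hn : (R.subgroupOf (R ⊔ Subgroup.zpowers x)).Normal :=
    (Subgroup.normal_subgroupOf_iff_le_normalizer le_sup_left).2 (sup_le Subgroup.le_normalizer hle)
  refine ⟨hn, ?_⟩
  have h1 : R.relIndex (R ⊔ Subgroup.zpowers x) = R.relIndex (Subgroup.zpowers x) := by
    rw [← Subgroup.relIndex_subgroupOf (sup_le Subgroup.le_normalizer hle),
      Subgroup.subgroupOf_sup Subgroup.le_normalizer hle, Subgroup.relIndex_sup_left,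
      Subgroup.relIndex_subgroupOf hle]
  rw [h1]
  have h2 : R.relIndex (Subgroup.zpowers x) ∣ q ^ k := by
    refine (Subgroup.relIndex_dvd_card _ _).trans ?_
    rw [Nat.card_zpowers]
    exact orderOf_dvd_of_pow_eq_one hxk
  obtain ⟨m, -, hm⟩ := (Nat.dvd_prime_pow hq).1 h2
  exact ⟨m, hm⟩

variable [Finite G]

/-- A `q`-element acting nontrivially on a `p`-subgroup produces a Schmidt subgroup. -/
theorem exists_isSchmidtGroup {p q : ℕ} (hp : p.Prime) (hq : q.Prime) (hpq : p ≠ q)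
    {R : Subgroup G} (hR : IsPGroup p R) (h : HasQAction q R) :
    ∃ S : Subgroup G, IsSchmidtGroup p q S := by
  have := Fact.mk hp
  have := Fact.mk hq
  obtain ⟨x, hxN, ⟨k, hk⟩, hxC⟩ := h
  set Y := R ⊔ Subgroup.zpowers x
  obtain ⟨hnormal, m, hm⟩ := relIndex_sup_zpowers hq hxN hk
  have hxY : x ∈ Y := (le_sup_right : _ ≤ Y) (Subgroup.mem_zpowers x)
  have hY : ¬ Group.IsNilpotent Y := by
    intro hY
    refine hxC (Subgroup.mem_centralizer_iff.2 fun r hr => ?_)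
    obtain ⟨j, hj⟩ := hR ⟨r, hr⟩
    have := commute_of_isNilpotent (G := Y) hp hq hpq (x := ⟨r, (le_sup_left : R ≤ Y) hr⟩)
      (y := ⟨x, hxY⟩) (j := j) (k := k)
      (Subtype.ext (by simpa [Subtype.ext_iff] using hj)) (Subtype.ext hk)
    exact congrArg Subtype.val this.eq
  -- A minimal non-nilpotent subgroup of R⟨x⟩ works: its intersection with R is normal of q-power
  -- index, so it is a normal Sylow p-subgroup.
  obtain ⟨S, hS⟩ := (Set.toFinite {S : Subgroup G | S ≤ Y ∧ ¬ Group.IsNilpotent S}).exists_minimal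
    ⟨Y, le_rfl, hY⟩
  have hSY := hS.1.1
  have hSR : IsPGroup p (R.subgroupOf S) := hR.comap_of_injective _ S.subtype_injective
  have hSn : (R.subgroupOf S).Normal := by
    refine ⟨fun r hr y => ?_⟩
    exact hnormal.conj_mem ⟨r, hSY r.2⟩ hr ⟨y, hSY y.2⟩
  have hSi : (R.subgroupOf S).index ∣ q ^ m := by
    rw [← hm]
    change R.relIndex S ∣ _
    rw [← Subgroup.relIndex_subgroupOf hSY]
    exact Subgroup.relIndex_dvd_index_of_normal _ _
  have hcard : Nat.card S ∣ Nat.card R * q ^ m := by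
    rw [← hm, ← Nat.card_congr (Subgroup.subgroupOfEquivOfLe (le_sup_left : R ≤ Y)).toEquiv]
    exact (Subgroup.card_dvd_of_le hSY).trans (Subgroup.card_mul_index _).symm.dvd
  refine ⟨S, hS.1.2, fun H hH => ?_, ?_, hSR.toSylow ?_, hSn⟩
  · by_contra hHn
    have h1 : S ≤ H.map S.subtype := hS.2 ⟨(Subgroup.map_subtype_le H).trans hSY, fun h =>
      hHn ((Group.isNilpotent_congr (H.equivMapOfInjective _ S.subtype_injective)).2 h)⟩
      (Subgroup.map_subtype_le H)
    exact hH (top_le_iff.1 fun y _ => by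
      obtain ⟨z, hz, hzy⟩ := h1 y.2
      rwa [← Subtype.ext hzy])
  · have hsub : primeDivisors S ⊆ {p, q} := by
      rintro d ⟨hd, hdS⟩
      obtain ⟨n, hn⟩ := IsPGroup.iff_card.1 hR
      rw [hn] at hcard
      rcases hd.dvd_mul.1 (hdS.trans hcard) with h | h
      · exact Or.inl ((Nat.prime_dvd_prime_iff_eq hd hp).1 (hd.dvd_of_dvd_pow h))
      · exact Or.inr ((Nat.prime_dvd_prime_iff_eq hd hq).1 (hd.dvd_of_dvd_pow h))
    refine hsub.antisymm ?_
    rintro d (rfl | rfl) <;> by_contra hd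
    · refine hS.1.2 (isNilpotent_of_primeDivisors_subset hq fun r hr => ?_)
      exact (hsub hr).resolve_left fun h => hd (h ▸ hr)
    · refine hS.1.2 (isNilpotent_of_primeDivisors_subset hp fun r hr => ?_)
      exact (hsub hr).resolve_right fun h => hd (h ▸ hr)
  · exact fun h => hpq ((Nat.prime_dvd_prime_iff_eq hp hq).1 (hp.dvd_of_dvd_pow (h.trans hSi)))

/-- Edges of the `N`-critical graph through `q`-elements acting on `p`-subgroups. -/
theorem mem_nCriticalGraph_edges_iff {G : Type u} [Group G] [Finite G] {p q : ℕ} :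
    (p, q) ∈ (nCriticalGraph G).edges ↔
      p.Prime ∧ q.Prime ∧ p ≠ q ∧ ∃ R : Subgroup G, IsPGroup p R ∧ HasQAction q R := by
  constructor
  · rintro ⟨⟨⟨hp, -⟩, hq, -⟩, S, hS⟩
    obtain ⟨P, hP, x, hxN, ⟨k, hk⟩, hxC⟩ := hS.exists_hasQAction
    refine ⟨hp, hq, hS.ne, P.map S.subtype, hP.map _, x, ?_, ⟨k, congrArg Subtype.val hk⟩, ?_⟩
    · exact Subgroup.le_normalizer_map _ (Subgroup.mem_map_of_mem S.subtype hxN)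
    · refine fun h => hxC (Subgroup.mem_centralizer_iff.2 fun r hr => Subtype.ext ?_)
      exact Subgroup.mem_centralizer_iff.1 h r (Subgroup.mem_map_of_mem S.subtype hr)
  · rintro ⟨hp, hq, hpq, R, hR, h⟩
    exact ⟨⟨⟨hp, h.prime_dvd_card_left hp hR⟩, hq, h.prime_dvd_card hq⟩,
      exists_isSchmidtGroup hp hq hpq hR h⟩

end Schmidt

/-! ### Lifting actions along surjections and projecting them from direct products. -/

section Lift

variable {G H : Type*} [Group G] [Group H] [Finite G]

theorem mem_of_mul_centralizes {p q : ℕ} (hp : p.Prime) (hq : q.Prime) (hpq : p ≠ q)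
    {R : Subgroup H} (hR : IsPGroup p R) {x r : H} {k : ℕ} (hx : x ^ q ^ k = 1) (hr : r ∈ R)
    (h : r * x ∈ Subgroup.centralizer (R : Set H)) : x ∈ Subgroup.centralizer (R : Set H) := by
  obtain ⟨j, hj⟩ := hR ⟨r, hr⟩
  have hj' : r ^ p ^ j = 1 := by simpa [Subtype.ext_iff] using hj
  refine mem_of_pow_mem_of_coprime (m := q ^ k) (n := p ^ j)
      (Nat.Coprime.pow _ _ ((Nat.coprime_primes hq hp).2 hpq.symm)) (hx ▸ one_mem _) ?_
  have hc : Commute r (r * x) := Subgroup.mem_centralizer_iff.1 h r hr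
  have : x = r⁻¹ * (r * x) := by group
  rw [this, hc.inv_left.mul_pow, inv_pow, hj', inv_one, one_mul]
  exact pow_mem h _

omit [Finite G] in
theorem exists_mul_pow_of_mem_normalizer {R : Subgroup G} {a b : G} (ha : a ∈ R)
    (hb : b ∈ Subgroup.normalizer (R : Set G)) (n : ℕ) : ∃ r ∈ R, (a * b) ^ n = r * b ^ n := by
  induction n with
  | zero => exact ⟨1, one_mem _, by simp⟩
  | succ n ih =>
    obtain ⟨r, hr, h⟩ := ih
    exact ⟨r * (b ^ n * a * (b ^ n)⁻¹),
      mul_mem hr ((Subgroup.mem_normalizer_iff.1 (pow_mem hb n) a).1 ha),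
      by rw [pow_succ, h, pow_succ]; group⟩

/-- Frattini argument for an element normalizing a subgroup `M`. -/
theorem exists_mul_mem_normalizer_sylow {p : ℕ} [Fact p.Prime] {M : Subgroup G} (P : Sylow p M)
    {x : G} (hx : x ∈ Subgroup.normalizer (M : Set G)) :
    ∃ m ∈ M, m * x ∈ Subgroup.normalizer ((P : Subgroup M).map M.subtype : Set G) := by
  set α : MulAut M := Subgroup.normalizerMonoidHom M ⟨x, hx⟩
  obtain ⟨n, hn⟩ := MulAction.exists_smul_eq M (α • P) P
  refine ⟨n, n.2, Subgroup.mem_normalizer_fintype ?_⟩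
  rintro _ ⟨u, hu, rfl⟩
  have h1 : α u ∈ α • P := Subgroup.smul_mem_pointwise_smul u α (P : Subgroup M) hu
  have h2 : MulAut.conj n • (α u) ∈ MulAut.conj n • (α • P : Sylow p M) :=
    Subgroup.smul_mem_pointwise_smul (α u) (MulAut.conj n) (α • P : Sylow p M).1 h1
  rw [← Sylow.smul_def, hn] at h2
  refine ⟨_, h2, ?_⟩
  change (n : G) * (x * u * x⁻¹) * (n : G)⁻¹ = _
  simp [mul_assoc]

/-- Nontrivial actions of `q`-elements on `p`-subgroups lift along surjections, and a Sylow
subgroup is lifted to a Sylow subgroup. -/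
theorem exists_hasQAction_of_surjective {p q : ℕ} (hp : p.Prime) (hq : q.Prime) (hpq : p ≠ q)
    {f : G →* H} (hf : Function.Surjective f) {R : Subgroup H} (hR : IsPGroup p R)
    (h : HasQAction q R) :
    ∃ P : Subgroup G, IsPGroup p P ∧ HasQAction q P ∧ (¬ p ∣ R.index → ¬ p ∣ P.index) := by
  have := Fact.mk hp
  obtain ⟨x, hxN, ⟨k, hk⟩, hxC⟩ := h
  set M := R.comap f with hM
  let P₀ : Sylow p M := default
  set P : Subgroup G := (P₀ : Subgroup M).map M.subtype with hP
  have hPp : IsPGroup p P := P₀.2.map _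
  have hPM : P ≤ M := Subgroup.map_subtype_le _
  have hMR : M.map f = R := Subgroup.map_comap_eq_self_of_surjective hf R
  -- the image of `P` is all of `R`
  have hPR : P.map f = R := by
    have hsurj := f.subgroupComap_surjective_of_surjective R hf
    have htop : (⊤ : Subgroup R) = (P₀.mapSurjective hsurj : Sylow p R) :=
      (P₀.mapSurjective hsurj).3 (hR.to_subgroup ⊤) le_top
    refine le_antisymm ((Subgroup.map_mono hPM).trans hMR.le) fun r hr => ?_
    have h1 : (⟨r, hr⟩ : R) ∈ (P₀ : Subgroup M).map (f.subgroupComap R) := by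
      rw [← Sylow.coe_mapSurjective hsurj, ← htop]; trivial
    obtain ⟨u, hu, hur⟩ := h1
    exact ⟨u, ⟨u, hu, rfl⟩, congrArg Subtype.val hur⟩
  obtain ⟨x, rfl⟩ := hf x
  obtain ⟨m, hm, hy⟩ :=
    exists_mul_mem_normalizer_sylow P₀ (Subgroup.le_normalizer_comap f hxN : x ∈ _)
  have hfm : f m ∈ R := hm
  have hfin : Finite H := Finite.of_surjective f hf
  -- The exponent is taken for G × H, so that the same s makes (m x)^s a q-element of G and fixes
  -- the q-element f x of H.
  obtain ⟨s, hs1, hs2⟩ := exists_pow_projection (G × H) hq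
  obtain ⟨k', hk'⟩ := hs1 (m * x, 1)
  have hxs : f x ^ s = f x := congrArg Prod.snd (hs2 (1, f x) ⟨k, by
    rw [Prod.pow_mk, hk, one_pow]; rfl⟩)
  obtain ⟨r, hr, hrs⟩ := exists_mul_pow_of_mem_normalizer hfm hxN s
  refine ⟨P, hPp, ⟨(m * x) ^ s, pow_mem hy s, ⟨k', congrArg Prod.fst hk'⟩, fun hC => hxC ?_⟩, ?_⟩
  -- The image of (m x)^s is r · f x with r in R. If it centralizes R, then so does f x.
  · refine mem_of_mul_centralizes (r := r) hp hq hpq hR hk hr ?_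
    rw [hxs, ← map_mul, ← map_pow] at hrs
    rw [← hrs, ← hPR]
    refine Subgroup.mem_centralizer_iff.2 ?_
    rintro _ ⟨u, hu, rfl⟩
    rw [← map_mul, ← map_mul, Subgroup.mem_centralizer_iff.1 hC u hu]
  · intro hi
    -- |G : P| = |M : P₀| |G : M|, and |G : M| = |H : R|.
    rw [← Subgroup.index_comap_of_surjective R hf] at hi
    rw [hP, Subgroup.index_map_subtype]
    exact Nat.Prime.not_dvd_mul hp P₀.not_dvd_index hi

theorem exists_hasQAction_of_pi {ι : Type*} {B : ι → Type*} [∀ i, Group (B i)] {q : ℕ}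
    {R : Subgroup (∀ i, B i)} (h : HasQAction q R) :
    ∃ i, HasQAction q (R.map (Pi.evalMonoidHom B i)) := by
  obtain ⟨x, hxN, ⟨k, hk⟩, hxC⟩ := h
  simp only [Subgroup.mem_centralizer_iff, not_forall] at hxC
  obtain ⟨r, hr, hrx⟩ := hxC
  obtain ⟨i, hi⟩ := Function.ne_iff.1 hrx
  refine ⟨i, x i, Subgroup.le_normalizer_map _ (Subgroup.mem_map_of_mem (Pi.evalMonoidHom B i) hxN),
    ⟨k, by rw [← Pi.pow_apply, hk, Pi.one_apply]⟩, fun h => hi ?_⟩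
  exact Subgroup.mem_centralizer_iff.1 h (r i) ⟨r, hr, rfl⟩

end Lift

/-! ### Series of central chief factors reaching above the hypercenter. -/

section CentralSeries

variable {G : Type u} [Group G]

theorem mem_ker_factorAction {H K : Subgroup G} [H.Normal] [K.Normal] {g : G} :
    g ∈ (factorAction H K).ker ↔ ∀ h ∈ H, g * h * g⁻¹ * h⁻¹ ∈ K := by
  have key : ∀ h : G, g * h * g⁻¹ * h⁻¹ ∈ K ↔
      (g : G ⧸ K) * (h : G ⧸ K) * (g : G ⧸ K)⁻¹ = (h : G ⧸ K) := by
    intro h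
    rw [← QuotientGroup.eq_one_iff, QuotientGroup.mk_mul, QuotientGroup.mk_inv, mul_inv_eq_one]
    rfl
  rw [MonoidHom.mem_ker]
  constructor
  · intro hg h hh
    have h1 := DFunLike.congr_fun hg
      (⟨(h : G ⧸ K), Subgroup.mem_map_of_mem (QuotientGroup.mk' K) hh⟩ : factor H K)
    exact (key h).2 (congrArg Subtype.val h1)
  · intro hg
    ext ⟨_, h, hh, rfl⟩
    exact (key h).1 (hg h hh)

/-- The isomorphism H'/(K ∩ H') ≅ KH'/K respects conjugation by G, so both factors have the same
centralizer and isomorphic semidirect products. -/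
theorem isCentralFactor_of_sup {F : GroupClass.{u}} {H K H' K' : Subgroup G} [H.Normal] [K.Normal]
    [H'.Normal] [K'.Normal] (hK' : K' = K ⊓ H') (hH : H = K ⊔ H')
    (h : IsCentralFactor F H' K') : IsCentralFactor F H K := by
  have hle : K' ≤ K.comap (MonoidHom.id G) := by rw [hK']; exact inf_le_left
  let φ : G ⧸ K' →* G ⧸ K := QuotientGroup.map K' K (MonoidHom.id G) hle
  have hH'H : H' ≤ H := hH ▸ le_sup_right
  have hφ : ∀ x : factor H' K', φ x ∈ factor H K := by
    rintro ⟨_, x, hx, rfl⟩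
    exact ⟨x, hH'H hx, rfl⟩
  let ψ : factor H' K' →* factor H K := (φ.comp (factor H' K').subtype).codRestrict _ hφ
  have hinj : Function.Injective ψ := by
    rw [injective_iff_map_eq_one]
    rintro ⟨_, x, hx, rfl⟩ h1
    have h2 : (x : G ⧸ K) = 1 := congrArg Subtype.val h1
    refine Subtype.ext ((QuotientGroup.eq_one_iff x).2 ?_)
    rw [hK']
    exact ⟨(QuotientGroup.eq_one_iff x).1 h2, hx⟩
  have hsurj : Function.Surjective ψ := by
    rintro ⟨_, x, hx, rfl⟩
    rw [hH, SetLike.mem_coe, Subgroup.mem_sup_of_normal_left] at hx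
    obtain ⟨k, hk, y, hy, rfl⟩ := hx
    refine ⟨⟨(y : G ⧸ K'), y, hy, rfl⟩, Subtype.ext ?_⟩
    change (y : G ⧸ K) = ((k * y : G) : G ⧸ K)
    rw [QuotientGroup.mk_mul, (QuotientGroup.eq_one_iff k).2 hk, one_mul]
  have hker : (factorAction H' K').ker = (factorAction H K).ker := by
    ext g
    rw [mem_ker_factorAction, mem_ker_factorAction]
    constructor
    · intro hg x hx
      rw [hH, Subgroup.mem_sup_of_normal_left] at hx
      obtain ⟨k, hk, y, hy, rfl⟩ := hx
      have h1 : g * y * g⁻¹ * y⁻¹ ∈ K := (hK'.le (hg y hy)).1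
      have h2 : g * (k * y) * g⁻¹ * (k * y)⁻¹ =
          (g * k * g⁻¹) * (g * y * g⁻¹ * y⁻¹) * k⁻¹ := by group
      rw [h2]
      exact mul_mem (mul_mem (Subgroup.Normal.conj_mem ‹_› k hk g) h1) (inv_mem hk)
    · intro hg x hx
      rw [hK']
      exact ⟨hg x (hH'H hx),
        mul_mem (Subgroup.Normal.conj_mem ‹_› x hx g) (H'.inv_mem hx)⟩
  refine F.mem_of_mulEquiv _ _ (SemidirectProduct.congr (MulEquiv.ofBijective ψ ⟨hinj, hsurj⟩)
    (QuotientGroup.quotientMulEquivOfEq hker) ?_) h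
  intro g
  obtain ⟨g, rfl⟩ := QuotientGroup.mk_surjective g
  ext ⟨_, x, hx, rfl⟩
  rfl

/-- The normal subgroups reached from `⊥` by a series of `𝔉`-central chief factors. -/
inductive CentralSeries (F : GroupClass.{u}) : Subgroup G → Prop
  | bot : CentralSeries F ⊥
  | step {H K : Subgroup G} [H.Normal] [K.Normal] :
      CentralSeries F K → IsChiefFactor H K → IsCentralFactor F H K → CentralSeries F H

theorem CentralSeries.normal {F : GroupClass.{u}} {H : Subgroup G} (h : CentralSeries F H) :
    H.Normal := by
  cases h
  · infer_instance
  · assumption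

/-- A normal subgroup with a series of `𝔉`-central chief factors contains the hypercenter. -/
theorem exists_centralSeries_ge_hypercenter [Finite G] (F : GroupClass.{u}) :
    ∃ M : Subgroup G, CentralSeries F M ∧ hypercenter G F ≤ M := by
  obtain ⟨M, hM⟩ := (Set.toFinite {M : Subgroup G | CentralSeries F M}).exists_maximal
    ⟨⊥, CentralSeries.bot⟩
  have hMc : CentralSeries F M := hM.1
  have := hMc.normal
  refine ⟨M, hMc, sSup_le fun N hN => ?_⟩
  by_contra hNM
  have := hN.1
  -- If M misses a hypercentral N, a minimal H/M inside MN/M is a chief factor. It is G-isomorphic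
  -- to one below N, hence central, and M was not maximal.
  obtain ⟨H, hH⟩ := (Set.toFinite {H : Subgroup G | H.Normal ∧ M < H ∧ H ≤ M ⊔ N}).exists_minimal
    ⟨M ⊔ N, inferInstance, left_lt_sup.2 hNM, le_rfl⟩
  obtain ⟨hHn, hMH, hHN⟩ := hH.1
  have hHeq : H = M ⊔ (H ⊓ N) := by
    refine le_antisymm (fun x hx => ?_) (sup_le hMH.le inf_le_left)
    obtain ⟨m, hm, n, hn, rfl⟩ := Subgroup.mem_sup_of_normal_left.1 (hHN hx)
    exact Subgroup.mul_mem_sup hm ⟨(Subgroup.mul_mem_cancel_left _ (hMH.le hm)).1 hx, hn⟩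
  have hcf : IsChiefFactor H M := by
    refine ⟨hHn, inferInstance, hMH, fun L hL hML hLH => ?_⟩
    rcases hML.eq_or_lt with h | h
    · exact Or.inl h.symm
    · exact Or.inr (le_antisymm hLH (hH.2 ⟨hL, h, hLH.trans hHN⟩ hLH))
  have hchief : IsChiefFactor (H ⊓ N) (M ⊓ (H ⊓ N)) := by
    refine ⟨inferInstance, inferInstance, inf_le_right.lt_of_ne fun h => ?_, fun L hL hKL hLH => ?_⟩
    · rw [inf_eq_right] at h
      exact hMH.ne (hHeq.trans (sup_eq_left.2 h)).symm
    · rcases hcf.2.2.2 (M ⊔ L) inferInstance le_sup_left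
        (sup_le hMH.le (hLH.trans inf_le_left)) with h | h
      · exact Or.inl (le_antisymm (le_inf (sup_eq_left.1 h) hLH) hKL)
      · refine Or.inr (le_antisymm hLH fun x hx => ?_)
        obtain ⟨m, hm, n, hn, rfl⟩ := Subgroup.mem_sup_of_normal_left.1 (h.ge hx.1)
        refine mul_mem (hKL ⟨hm, ?_⟩) hn
        exact (Subgroup.mul_mem_cancel_right _ (hLH hn)).1 hx
  have hcen := hN.2 (H ⊓ N) (M ⊓ (H ⊓ N)) hchief inf_le_right
  have h1 : CentralSeries F H := .step hMc hcf (isCentralFactor_of_sup rfl hHeq hcen)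
  exact hMH.not_ge (hM.2 h1 hMH.le)

end CentralSeries

/-! ### Coprime action along a central series. -/

section CentralAction

/-- In the semidirect product of a subgroup with an acting `q`-element the same action is visible
on a Sylow subgroup of the generated subgroup. -/
theorem exists_sylow_hasQAction {X : Type*} [Group X] [Finite X] {p q : ℕ} (hp : p.Prime)
    (hq : q.Prime) (hpq : p ≠ q) {R : Subgroup X} (hR : IsPGroup p R) (h : HasQAction q R) :
    ∃ (Y : Subgroup X) (P : Sylow p Y), HasQAction q (P : Subgroup Y) := by
  have := Fact.mk hp
  obtain ⟨x, hxN, ⟨k, hk⟩, hxC⟩ := h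
  obtain ⟨hnormal, m, hm⟩ := relIndex_sup_zpowers hq hxN hk
  set Y := R ⊔ Subgroup.zpowers x
  have hxY : x ∈ Y := (le_sup_right : _ ≤ Y) (Subgroup.mem_zpowers x)
  have hRY : IsPGroup p (R.subgroupOf Y) := hR.comap_of_injective _ Y.subtype_injective
  refine ⟨Y, hRY.toSylow fun h => ?_, ⟨x, hxY⟩, ?_, ⟨k, Subtype.ext hk⟩, fun hC => hxC ?_⟩
  · change p ∣ R.relIndex Y at h
    rw [hm] at h
    exact hpq ((Nat.prime_dvd_prime_iff_eq hp hq).1 (hp.dvd_of_dvd_pow h))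
  · rw [IsPGroup.toSylow_coe, Subgroup.normalizer_eq_top]
    trivial
  · refine Subgroup.mem_centralizer_iff.2 fun r hr => ?_
    have h1 := Subgroup.mem_centralizer_iff.1 hC ⟨r, (le_sup_left : R ≤ Y) hr⟩ hr
    exact congrArg Subtype.val h1

variable {G : Type u} [Group G] {F : GroupClass.{u}}

/-- A `q`-element acting nontrivially on the trace of a `p`-subgroup in a central chief factor. -/
theorem exists_mem_hasQAction_of_isCentralFactor {p q : ℕ}
    (hher : F.IsHereditary) (hp : p.Prime) (hq : q.Prime) (hpq : p ≠ q) {H K : Subgroup G}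
    [H.Normal] [K.Normal] (hc : IsCentralFactor F H K)
    {R : Subgroup G} (hR : IsPGroup p R) {x r : G} {k : ℕ}
    (hx : x ∈ Subgroup.normalizer (R : Set G)) (hxk : x ^ q ^ k = 1) (hr : r ∈ R) (hrH : r ∈ H)
    (hxr : x * r * x⁻¹ * r⁻¹ ∉ K) :
    ∃ (Y : Type u) (_ : Group Y) (_ : Finite Y) (P : Sylow p Y),
      F.Mem Y ∧ HasQAction q (P : Subgroup Y) := by
  let X := SemidirectProduct (factor H K) (G ⧸ (factorAction H K).ker)
    (QuotientGroup.kerLift (factorAction H K))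
  have hX : Finite X := F.finite_of_mem X hc
  let R₁ : Subgroup (factor H K) := ((R ⊓ H).map (QuotientGroup.mk' K)).subgroupOf (factor H K)
  have hR₁ : IsPGroup p R₁ :=
    ((hR.to_le inf_le_left).map _).comap_of_injective _ (Subgroup.subtype_injective _)
  let R₂ : Subgroup X := R₁.map SemidirectProduct.inl
  have hR₂ : IsPGroup p R₂ := hR₁.map _
  let x₂ : X := SemidirectProduct.inr (x : G ⧸ (factorAction H K).ker)
  have conj : ∀ n : G, ∀ hn : n ∈ H, x₂ * SemidirectProduct.inl
      ⟨(n : G ⧸ K), Subgroup.mem_map_of_mem (QuotientGroup.mk' K) hn⟩ * x₂⁻¹ = 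
      SemidirectProduct.inl ⟨((x * n * x⁻¹ : G) : G ⧸ K),
        Subgroup.mem_map_of_mem (QuotientGroup.mk' K) (Subgroup.Normal.conj_mem ‹_› n hn x)⟩ := by
    intro n hn
    have h := SemidirectProduct.inl_aut (φ := QuotientGroup.kerLift (factorAction H K))
      (x : G ⧸ (factorAction H K).ker)
      ⟨(n : G ⧸ K), Subgroup.mem_map_of_mem (QuotientGroup.mk' K) hn⟩
    rw [map_inv] at h
    exact h.symm
  have hact : HasQAction q R₂ := by
    refine ⟨x₂, Subgroup.mem_normalizer_fintype ?_, ⟨k, ?_⟩, fun hC => hxr ?_⟩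
    · rintro _ ⟨⟨_, _⟩, ⟨n, hn, rfl⟩, rfl⟩
      refine ⟨_, ?_, (conj n hn.2).symm⟩
      exact ⟨x * n * x⁻¹, ⟨(Subgroup.mem_normalizer_iff.1 hx n).1 hn.1,
        Subgroup.Normal.conj_mem ‹_› n hn.2 x⟩, rfl⟩
    · change (SemidirectProduct.inr (x : G ⧸ (factorAction H K).ker) : X) ^ q ^ k = 1
      rw [← map_pow, ← QuotientGroup.mk_pow, hxk, QuotientGroup.mk_one, map_one]
    · have h1 := Subgroup.mem_centralizer_iff.1 hC (SemidirectProduct.inl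
        ⟨(r : G ⧸ K), Subgroup.mem_map_of_mem (QuotientGroup.mk' K) hrH⟩)
        ⟨_, ⟨r, ⟨hr, hrH⟩, rfl⟩, rfl⟩
      have h2 := (conj r hrH).symm.trans (mul_inv_eq_iff_eq_mul.2 h1.symm)
      have h3 := congrArg Subtype.val (SemidirectProduct.inl_injective h2)
      have h4 : ((x * r * x⁻¹ : G) : G ⧸ K) = (r : G ⧸ K) := h3
      rw [← QuotientGroup.eq_one_iff, QuotientGroup.mk_mul, QuotientGroup.mk_inv, h4,
        mul_inv_cancel]
  obtain ⟨Y, P, hP⟩ := exists_sylow_hasQAction hp hq hpq hR₂ hact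
  exact ⟨Y, inferInstance, inferInstance, P, hher X Y hc, hP⟩

/-- Induction down the series: each central factor H/K moves the commutators [x, R] from H into K,
until they are trivial. -/
theorem mem_centralizer_of_centralSeries {p q : ℕ}
    (hher : F.IsHereditary) (hp : p.Prime) (hq : q.Prime) (hpq : p ≠ q) {M : Subgroup G}
    (hM : CentralSeries F M) {R : Subgroup G} (hR : IsPGroup p R) {x : G} {k : ℕ}
    (hx : x ∈ Subgroup.normalizer (R : Set G)) (hxk : x ^ q ^ k = 1)
    (hxR : ∀ r ∈ R, x * r * x⁻¹ * r⁻¹ ∈ M)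
    (hF : ∀ (Y : Type u) [Group Y] [Finite Y] (P : Sylow p Y), F.Mem Y →
      ¬ HasQAction q (P : Subgroup Y)) : x ∈ Subgroup.centralizer (R : Set G) := by
  induction hM with
  | bot =>
    refine Subgroup.mem_centralizer_iff.2 fun r hr => ?_
    have h := Subgroup.mem_bot.1 (hxR r hr)
    rw [mul_inv_eq_one, mul_inv_eq_iff_eq_mul] at h
    exact h.symm
  | @step H K _ _ _ _ hc ih =>
    have h1 : ∀ r ∈ R, r ∈ H → x * r * x⁻¹ * r⁻¹ ∈ K := by
      intro r hr hrH
      by_contra hcon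
      obtain ⟨Y, _, _, P, hY, hP⟩ :=
        exists_mem_hasQAction_of_isCentralFactor hher hp hq hpq hc hR hx hxk hr hrH hcon
      exact hF Y P hY hP
    refine ih fun r hr => ?_
    set c := x * r * x⁻¹ * r⁻¹ with hc'
    have hcR : c ∈ R := mul_mem ((Subgroup.mem_normalizer_iff.1 hx r).1 hr) (R.inv_mem hr)
    -- c lies in R ∩ H, so x commutes with c modulo K. Hence c ^ q ^ k is in K, while c is a
    -- p-element, and therefore c is in K.
    have h2 := h1 c hcR (hxR r hr)
    have h3 : (c : G ⧸ K) ^ q ^ k = 1 := by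
      have h4 := pow_conj_of_commutator (x := (x : G ⧸ K)) (r := (r : G ⧸ K)) (c := (c : G ⧸ K))
        ?_ ?_ (q ^ k)
      · have h5 : (x : G ⧸ K) ^ q ^ k = 1 := by rw [← QuotientGroup.mk_pow, hxk]; rfl
        rw [h5] at h4
        simpa using h4.symm
      · rw [hc']
        simp
      · rw [← QuotientGroup.eq_one_iff] at h2
        rwa [← mul_inv_eq_one]
    obtain ⟨j, hj⟩ := hR ⟨c, hcR⟩
    refine mem_of_pow_mem_of_coprime (m := q ^ k) (n := p ^ j)
      (Nat.Coprime.pow _ _ ((Nat.coprime_primes hq hp).2 hpq.symm)) ?_ ?_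
    · rwa [← QuotientGroup.eq_one_iff, QuotientGroup.mk_pow]
    · have : c ^ p ^ j = 1 := congrArg Subtype.val hj
      rw [this]
      exact one_mem _

end CentralAction

/-! ### Index and order conditions expressed through powers of elements. -/

section PowInto

variable {G : Type*} [Group G]

/-- Every element of `V` has a power with exponent in `S` lying in `K`. -/
def PowInto (S : Submonoid ℕ) (V K : Subgroup G) : Prop :=
  ∀ v ∈ V, ∃ m ∈ S, v ^ m ∈ K

/-- The submonoid of natural numbers coprime to `p`. -/
def coprimeTo (p : ℕ) : Submonoid ℕ where
  carrier := {m | m.Coprime p}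
  mul_mem' := fun ha hb => Nat.Coprime.mul_left ha hb
  one_mem' := Nat.coprime_one_left p

variable {S : Submonoid ℕ}

theorem PowInto.trans {V L K : Subgroup G} (h : PowInto S V L) (h' : PowInto S L K) :
    PowInto S V K := by
  intro v hv
  obtain ⟨m, hm, hvm⟩ := h v hv
  obtain ⟨n, hn, hvn⟩ := h' _ hvm
  exact ⟨m * n, mul_mem hm hn, by rwa [pow_mul]⟩

theorem PowInto.mono {V V' K K' : Subgroup G} (h : PowInto S V K) (hV : V' ≤ V) (hK : K ≤ K') :
    PowInto S V' K' := fun v hv =>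
  let ⟨m, hm, hvm⟩ := h v (hV hv)
  ⟨m, hm, hK hvm⟩

theorem PowInto.map {H : Type*} [Group H] (f : G →* H) {V K : Subgroup G} (h : PowInto S V K) :
    PowInto S (V.map f) (K.map f) := by
  rintro _ ⟨v, hv, rfl⟩
  obtain ⟨m, hm, hvm⟩ := h v hv
  exact ⟨m, hm, by rw [← map_pow]; exact Subgroup.mem_map_of_mem f hvm⟩

theorem PowInto.comap {H : Type*} [Group H] (f : G →* H) {V K : Subgroup H} (h : PowInto S V K) :
    PowInto S (V.comap f) (K.comap f) := by
  intro v hv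
  obtain ⟨m, hm, hvm⟩ := h _ hv
  exact ⟨m, hm, by rwa [← map_pow] at hvm⟩

/-- Modulo W a product v w is just v, so its power falls into W first and then into K. -/
theorem PowInto.sup {V W K : Subgroup G} [W.Normal] (h : PowInto S V K) (h' : PowInto S W K)
    (hKW : K ≤ W) : PowInto S (V ⊔ W) K := by
  refine PowInto.trans (L := W) (fun g hg => ?_) h'
  obtain ⟨v, hv, w, hw, rfl⟩ := Subgroup.mem_sup_of_normal_right.1 hg
  obtain ⟨m, hm, hvm⟩ := h v hv
  refine ⟨m, hm, (QuotientGroup.eq_one_iff _).1 ?_⟩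
  rw [QuotientGroup.mk_pow, QuotientGroup.mk_mul, (QuotientGroup.eq_one_iff w).2 hw, mul_one,
    ← QuotientGroup.mk_pow, QuotientGroup.eq_one_iff]
  exact hKW hvm

theorem PowInto.sSup [Finite G] {s : Set (Subgroup G)} (hs : ∀ N ∈ s, N.Normal ∧ PowInto S N ⊥) :
    PowInto S (sSup s) ⊥ := by
  obtain ⟨M, hM⟩ := (Set.toFinite {M : Subgroup G | M.Normal ∧ PowInto S M ⊥}).exists_maximal
    ⟨⊥, inferInstance, fun v hv => ⟨1, one_mem _, by simpa using hv⟩⟩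
  obtain ⟨hMn, hMS⟩ := hM.1
  refine hMS.mono (sSup_le fun N hN => ?_) le_rfl
  have := (hs N hN).1
  exact le_sup_left.trans (hM.2 ⟨Subgroup.sup_normal N M, (hs N hN).2.sup hMS bot_le⟩ le_sup_right)

theorem powInto_coprimeTo_top_iff [Finite G] {q : ℕ} (hq : q.Prime) {N : Subgroup G} [N.Normal] :
    PowInto (coprimeTo q) ⊤ N ↔ ¬ q ∣ N.index := by
  have := Fact.mk hq
  constructor
  · intro h hdvd
    obtain ⟨x, hx⟩ := exists_prime_orderOf_dvd_card' (G := G ⧸ N) q hdvd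
    obtain ⟨g, rfl⟩ := QuotientGroup.mk_surjective x
    obtain ⟨m, hm, hgm⟩ := h g trivial
    have h1 : (g : G ⧸ N) ^ m = 1 := by rwa [← QuotientGroup.mk_pow, QuotientGroup.eq_one_iff]
    have h2 := orderOf_dvd_of_pow_eq_one h1
    rw [hx] at h2
    exact (Nat.Prime.coprime_iff_not_dvd hq).1 (Nat.Coprime.symm hm) h2
  · intro h g _
    exact ⟨N.index, ((Nat.Prime.coprime_iff_not_dvd hq).2 h).symm, Subgroup.pow_index_mem _ _⟩

theorem powInto_coprimeTo_bot_iff [Finite G] {q : ℕ} (hq : q.Prime) {V : Subgroup G} :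
    PowInto (coprimeTo q) V ⊥ ↔ ¬ q ∣ Nat.card V := by
  rw [← Subgroup.index_bot, ← powInto_coprimeTo_top_iff hq]
  constructor
  · intro h v _
    obtain ⟨m, hm, hvm⟩ := h v v.2
    exact ⟨m, hm, Subtype.ext hvm⟩
  · intro h v hv
    obtain ⟨m, hm, hvm⟩ := h ⟨v, hv⟩ trivial
    exact ⟨m, hm, congrArg Subtype.val hvm⟩

theorem powInto_powers_bot_iff {p : ℕ} {V : Subgroup G} :
    PowInto (Submonoid.powers p) V ⊥ ↔ IsPGroup p V := by
  constructor
  · rintro h ⟨v, hv⟩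
    obtain ⟨_, ⟨k, rfl⟩, hk⟩ := h v hv
    exact ⟨k, Subtype.ext hk⟩
  · intro h v hv
    obtain ⟨k, hk⟩ := h ⟨v, hv⟩
    exact ⟨p ^ k, ⟨k, rfl⟩, congrArg Subtype.val hk⟩

theorem primeDivisors_subset_compl_iff {p : ℕ} (hp : p.Prime) {V : Type*} :
    primeDivisors V ⊆ {p}ᶜ ↔ ¬ p ∣ Nat.card V :=
  ⟨fun h hV => h ⟨hp, hV⟩ rfl, fun h _ hd hdp => h (hdp ▸ hd.2)⟩

theorem primeDivisors_subset_of_isPGroup {p : ℕ} (hp : p.Prime) {V : Type*} [Group V] [Finite V]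
    (h : IsPGroup p V) : primeDivisors V ⊆ {p} := by
  have := Fact.mk hp
  obtain ⟨n, hn⟩ := IsPGroup.iff_card.1 h
  rintro d ⟨hd, hdV⟩
  exact (Nat.prime_dvd_prime_iff_eq hd hp).1 (hd.dvd_of_dvd_pow (hn ▸ hdV))

end PowInto

/-! ### The p-nilpotent radical and p-nilpotence modulo a subgroup. -/

section PNilpotent

/-- The normal subgroup `D` is `p`-nilpotent modulo `K`. -/
def PNilpotentMod {G : Type*} [Group G] (p : ℕ) (D K : Subgroup G) : Prop :=
  ∃ V : Subgroup G, V.Normal ∧ V ≤ D ∧ PowInto (coprimeTo p) V K ∧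
    PowInto (Submonoid.powers p) D V

variable {G : Type*} [Group G] [Finite G] {p : ℕ}

theorem powInto_piCore_compl (hp : p.Prime) : PowInto (coprimeTo p) (piCore {p}ᶜ G) ⊥ :=
  PowInto.sSup fun _ hN => ⟨hN.1, (powInto_coprimeTo_bot_iff hp).2
    ((primeDivisors_subset_compl_iff hp).1 hN.2)⟩

theorem powInto_piCore (p : ℕ) (G : Type*) [Group G] [Finite G] :
    PowInto (Submonoid.powers p) (piCore {p} G) ⊥ :=
  PowInto.sSup fun _ hN => ⟨hN.1, powInto_powers_bot_iff.2 (isPGroup_of_primeDivisors_subset hN.2)⟩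

omit [Finite G] in
theorem piCore_compl_le_pNilpotentRadical : piCore {p}ᶜ G ≤ pNilpotentRadical p G := fun x hx => by
  change (x : G ⧸ piCore {p}ᶜ G) ∈ piCore {p} (G ⧸ piCore {p}ᶜ G)
  rw [(QuotientGroup.eq_one_iff x).2 hx]
  exact one_mem _

instance pNilpotentRadical_normal (p : ℕ) (G : Type*) [Group G] : (pNilpotentRadical p G).Normal :=
  Subgroup.Normal.comap inferInstance _

theorem powInto_pNilpotentRadical :
    PowInto (Submonoid.powers p) (pNilpotentRadical p G) (piCore {p}ᶜ G) := by
  have h := (powInto_piCore p (G ⧸ piCore {p}ᶜ G)).comap (QuotientGroup.mk' (piCore {p}ᶜ G))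
  rwa [MonoidHom.comap_bot, QuotientGroup.ker_mk'] at h

theorem pNilpotentMod_pNilpotentRadical (hp : p.Prime) :
    PNilpotentMod p (pNilpotentRadical p G) ⊥ :=
  ⟨piCore {p}ᶜ G, inferInstance, piCore_compl_le_pNilpotentRadical, powInto_piCore_compl hp,
    powInto_pNilpotentRadical⟩

theorem PNilpotentMod.le_pNilpotentRadical (hp : p.Prime) {D : Subgroup G} (hD : D.Normal)
    (h : PNilpotentMod p D ⊥) : D ≤ pNilpotentRadical p G := by
  obtain ⟨V, hVn, hVD, hV, hDV⟩ := h
  have hVc : V ≤ piCore {p}ᶜ G := le_sSup ⟨hVn, (primeDivisors_subset_compl_iff hp).2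
    ((powInto_coprimeTo_bot_iff hp).1 hV)⟩
  rw [pNilpotentRadical, ← Subgroup.map_le_iff_le_comap]
  refine le_sSup ⟨hD.map _ (QuotientGroup.mk'_surjective _), primeDivisors_subset_of_isPGroup hp
    (powInto_powers_bot_iff.1 ((hDV.map (QuotientGroup.mk' _)).mono le_rfl ?_))⟩
  rw [Subgroup.map_le_iff_le_comap, MonoidHom.comap_bot, QuotientGroup.ker_mk']
  exact hVc

omit [Finite G] in
theorem PNilpotentMod.inf {D K E : Subgroup G} [E.Normal] (h : PNilpotentMod p D K) :
    PNilpotentMod p (D ⊓ E) K := by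
  obtain ⟨V, hVn, hVD, hV, hDV⟩ := h
  refine ⟨V ⊓ E, inferInstance, inf_le_inf_right _ hVD, hV.mono inf_le_left le_rfl, ?_⟩
  rintro d ⟨hd, hdE⟩
  obtain ⟨m, hm, hdm⟩ := hDV d hd
  exact ⟨m, hm, hdm, pow_mem hdE m⟩

omit [Finite G] in
theorem PNilpotentMod.trans {D H K : Subgroup G} (h : PNilpotentMod p D H)
    (hHK : PowInto (coprimeTo p) H K) : PNilpotentMod p D K := by
  obtain ⟨V, hVn, hVD, hV, hDV⟩ := h
  exact ⟨V, hVn, hVD, hV.trans hHK, hDV⟩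

/-- A group with a central subgroup containing prime-to-`p` powers is `p`-nilpotent. -/
theorem exists_pNilpotent_of_central (hp : p.Prime) {V L : Subgroup G} (hVn : V.Normal)
    (hLV : ∀ v ∈ V, ∀ l ∈ L, Commute v l) (hV : PowInto (coprimeTo p) V L) :
    ∃ U : Subgroup G, U.Normal ∧ U ≤ V ∧ PowInto (coprimeTo p) U ⊥ ∧
      PowInto (Submonoid.powers p) V U := by
  have := Fact.mk hp
  let P : Sylow p V := default
  have hP : ∀ u ∈ P, (u : G) ∈ L := by
    intro u hu
    obtain ⟨m, hm, hum⟩ := hV u u.2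
    obtain ⟨k, hk⟩ := P.2 ⟨u, hu⟩
    refine mem_of_pow_mem_of_coprime (Nat.Coprime.pow_right k hm) hum ?_
    have : (u : G) ^ p ^ k = 1 := congrArg (fun z => ((z : V) : G)) (congrArg Subtype.val hk)
    rw [this]
    exact one_mem _
  -- The Sylow p-subgroup lies in L, hence is central in V, and Burnside's transfer theorem gives a
  -- normal p-complement.
  have hNC : Subgroup.normalizer (P : Set V) ≤ Subgroup.centralizer (P : Set V) := fun v _ =>
    Subgroup.mem_centralizer_iff.2 fun u hu => Subtype.ext (hLV v v.2 u (hP u hu)).eq.symm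
  set N := (MonoidHom.transferSylow P hNC).ker
  have hN1 : ¬ p ∣ Nat.card N := MonoidHom.not_dvd_card_ker_transferSylow P hNC
  obtain ⟨k, hk⟩ : ∃ k, N.index = p ^ k := by
    obtain ⟨k, hk⟩ := IsPGroup.iff_card.1 P.2
    exact ⟨k, (MonoidHom.ker_transferSylow_isComplement' P hNC).symm.index_eq_card.trans hk⟩
  -- The complement consists of the elements of V of order prime to p, a description invariant under
  -- conjugation by G.
  have hmem : ∀ v : V, v ∈ N ↔ ∃ m ∈ coprimeTo p, (v : G) ^ m = 1 := by
    intro v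
    constructor
    · intro hv
      obtain ⟨m, hm, hvm⟩ := (powInto_coprimeTo_bot_iff hp).2 hN1 v hv
      exact ⟨m, hm, congrArg Subtype.val hvm⟩
    · rintro ⟨m, hm, hvm⟩
      refine mem_of_pow_mem_of_coprime (n := p ^ k) (Nat.Coprime.pow_right k hm) ?_ ?_
      · rw [show v ^ m = 1 from Subtype.ext hvm]; exact one_mem _
      · rw [← hk]; exact Subgroup.pow_index_mem N v
  refine ⟨N.map V.subtype, ⟨?_⟩, Subgroup.map_subtype_le N, ?_, ?_⟩
  · rintro _ ⟨v, hv, rfl⟩ g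
    refine ⟨⟨g * v * g⁻¹, hVn.conj_mem v v.2 g⟩, (hmem _).2 ?_, rfl⟩
    obtain ⟨m, hm, hvm⟩ := (hmem v).1 hv
    exact ⟨m, hm, by simp [conj_pow, hvm]⟩
  · rintro _ ⟨v, hv, rfl⟩
    exact (hmem v).1 hv
  · intro v hv
    refine ⟨p ^ k, ⟨k, rfl⟩, ⟨v, hv⟩ ^ p ^ k, ?_, rfl⟩
    rw [← hk]
    exact Subgroup.pow_index_mem N _

/-- Modulo K, the subgroup V commutes with H, which contains prime-to-p powers of all its elements.
So V/K-images have a normal p-complement, whose preimage in V replaces V. -/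
theorem PNilpotentMod.of_centralizes (hp : p.Prime) {D H K : Subgroup G} [K.Normal]
    (h : PNilpotentMod p D H) (hDH : ∀ d ∈ D, ∀ x ∈ H, d * x * d⁻¹ * x⁻¹ ∈ K) :
    PNilpotentMod p D K := by
  obtain ⟨V, hVn, hVD, hV, hDV⟩ := h
  have hcomm : ∀ v ∈ V.map (QuotientGroup.mk' K), ∀ l ∈ H.map (QuotientGroup.mk' K),
      Commute v l := by
    rintro _ ⟨v, hv, rfl⟩ _ ⟨x, hx, rfl⟩
    have h1 := (QuotientGroup.eq_one_iff _).2 (hDH v (hVD hv) x hx)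
    rw [QuotientGroup.mk_mul, QuotientGroup.mk_inv, mul_inv_eq_one] at h1
    exact mul_inv_eq_iff_eq_mul.1 h1
  obtain ⟨U, hUn, hUV, hU, hVU⟩ := exists_pNilpotent_of_central hp
    (hVn.map (QuotientGroup.mk' K) (QuotientGroup.mk'_surjective K)) hcomm (hV.map _)
  refine ⟨V ⊓ U.comap (QuotientGroup.mk' K), inferInstance, inf_le_left.trans hVD, ?_,
    hDV.trans fun v hv => ?_⟩
  · have := hU.comap (QuotientGroup.mk' K)
    rw [MonoidHom.comap_bot, QuotientGroup.ker_mk'] at this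
    exact this.mono inf_le_right le_rfl
  · obtain ⟨m, hm, hvm⟩ := hVU v (Subgroup.mem_map_of_mem (QuotientGroup.mk' K) hv)
    exact ⟨m, hm, pow_mem hv m, hvm⟩

end PNilpotent

/-! ### The Hawkes graph under images, products and central extensions. -/

section Hawkes

theorem pNilpotentRadical_eq_top {p : ℕ} (hp : p.Prime) {G : Type*} [Group G] [Finite G]
    (h : ¬ p ∣ Nat.card G) : pNilpotentRadical p G = ⊤ :=
  top_le_iff.1 (PNilpotentMod.le_pNilpotentRadical hp inferInstance
    ⟨⊤, inferInstance, le_rfl, (powInto_coprimeTo_bot_iff hp).2 (by rwa [Subgroup.card_top]),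
      fun v _ => ⟨1, one_mem _, trivial⟩⟩)

theorem mem_hawkesGraph_edges_iff {G : Type u} [Group G] [Finite G] {p q : ℕ} :
    (p, q) ∈ (hawkesGraph G).edges ↔
      p.Prime ∧ q.Prime ∧ ¬ PowInto (coprimeTo q) ⊤ (pNilpotentRadical p G) := by
  constructor
  · rintro ⟨⟨⟨hp, -⟩, hq, -⟩, -, hdvd⟩
    exact ⟨hp, hq, fun h => (powInto_coprimeTo_top_iff hq).1 h hdvd⟩
  · rintro ⟨hp, hq, h⟩
    rw [powInto_coprimeTo_top_iff hq, not_not] at h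
    refine ⟨⟨⟨hp, ?_⟩, hq, h.trans (Subgroup.index_dvd_card _)⟩, hq, h⟩
    by_contra hpG
    rw [pNilpotentRadical_eq_top hp hpG, Subgroup.index_top] at h
    exact hq.one_lt.ne' (Nat.dvd_one.1 h)

theorem powInto_pNilpotentRadical_of_surjective {p : ℕ} (hp : p.Prime) {S : Submonoid ℕ}
    {G H : Type*} [Group G] [Group H] [Finite G] {f : G →* H} (hf : Function.Surjective f)
    (h : PowInto S ⊤ (pNilpotentRadical p G)) : PowInto S ⊤ (pNilpotentRadical p H) := by
  have := Finite.of_surjective f hf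
  obtain ⟨V, hVn, hVD, hV, hDV⟩ := pNilpotentMod_pNilpotentRadical (G := G) hp
  have h1 : PNilpotentMod p ((pNilpotentRadical p G).map f) ⊥ :=
    ⟨V.map f, hVn.map f hf, Subgroup.map_mono hVD, by simpa using hV.map f, hDV.map f⟩
  have h2 := h.map f
  rw [Subgroup.map_top_of_surjective f hf] at h2
  exact h2.mono le_rfl (h1.le_pNilpotentRadical hp (Subgroup.Normal.map inferInstance f hf))

section Pi

variable {ι : Type*} [Finite ι] {B : ι → Type*} [∀ i, Group (B i)]

theorem PowInto.pi {S : Submonoid ℕ} {V K : ∀ i, Subgroup (B i)}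
    (h : ∀ i, PowInto S (V i) (K i)) :
    PowInto S (Subgroup.pi Set.univ V) (Subgroup.pi Set.univ K) := by
  have := Fintype.ofFinite ι
  intro v hv
  choose m hm hvm using fun i => h i (v i) (hv i trivial)
  refine ⟨∏ i, m i, Submonoid.prod_mem _ fun i _ => hm i, fun i _ => ?_⟩
  obtain ⟨c, hc⟩ := Finset.dvd_prod_of_mem m (Finset.mem_univ i)
  rw [Pi.pow_apply, hc, pow_mul]
  exact pow_mem (hvm i) c

omit [Finite ι] in
theorem pi_univ_normal {V : ∀ i, Subgroup (B i)} (h : ∀ i, (V i).Normal) :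
    (Subgroup.pi Set.univ V).Normal :=
  ⟨fun v hv g i _ => (h i).conj_mem (v i) (hv i trivial) (g i)⟩

theorem powInto_pNilpotentRadical_pi [∀ i, Finite (B i)] {p : ℕ} (hp : p.Prime) {S : Submonoid ℕ}
    (h : ∀ i, PowInto S ⊤ (pNilpotentRadical p (B i))) :
    PowInto S ⊤ (pNilpotentRadical p (∀ i, B i)) := by
  choose V hVn hVD hV hDV using fun i => pNilpotentMod_pNilpotentRadical (G := B i) hp
  have h1 : PNilpotentMod p (Subgroup.pi Set.univ fun i => pNilpotentRadical p (B i)) ⊥ :=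
    ⟨Subgroup.pi Set.univ V, pi_univ_normal hVn, fun v hv i _ => hVD i (hv i trivial),
      by rw [← Subgroup.pi_bot]; exact PowInto.pi hV, PowInto.pi hDV⟩
  have h2 := PowInto.pi h
  rw [Subgroup.pi_top] at h2
  exact h2.mono le_rfl (h1.le_pNilpotentRadical hp (pi_univ_normal fun i => inferInstance))

end Pi

/-- `O_{p',p}(X)` centralizes the minimal normal subgroups of order divisible by `p`. -/
theorem commute_of_mem_pNilpotentRadical {p : ℕ} (hp : p.Prime) {X : Type*} [Group X] [Finite X]
    {B : Subgroup X} [hB : B.Normal] (hmin : ∀ L : Subgroup X, L.Normal → L ≤ B → L = ⊥ ∨ L = B)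
    (hpB : p ∣ Nat.card B) {w b : X} (hw : w ∈ pNilpotentRadical p X) (hb : b ∈ B) :
    Commute w b := by
  have := Fact.mk hp
  obtain ⟨V, hVn, hVW, hV, hWV⟩ := pNilpotentMod_pNilpotentRadical (G := X) hp
  set W := pNilpotentRadical p X with hW
  have hWn : W.Normal := inferInstance
  rcases hmin (B ⊓ W) inferInstance inf_le_left with h | h
  · exact Subgroup.commute_of_normal_of_disjoint _ _ hWn hB (disjoint_iff.2 h).symm w b hw hb
  -- Now B ≤ W. Since |V| is prime to p and p divides |B|, V meets B trivially and centralizes it,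
  -- so W acts on B as a p-group.
  have hVB : V ⊓ B = ⊥ := by
    refine (hmin _ inferInstance inf_le_right).resolve_right fun h => ?_
    exact (powInto_coprimeTo_bot_iff hp).1 hV (hpB.trans (Subgroup.card_dvd_of_le (inf_eq_right.1 h)))
  have hcomm : ∀ v ∈ V, ∀ b ∈ B, Commute v b := fun v hv b hb =>
    Subgroup.commute_of_normal_of_disjoint _ _ hVn hB (disjoint_iff.2 hVB) v b hv hb
  let ρ : X →* MulAut B := MulAut.conjNormal
  have hρ : IsPGroup p (W.map ρ) := by
    rintro ⟨_, w, hw, rfl⟩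
    obtain ⟨_, ⟨k, rfl⟩, hk⟩ := hWV w hw
    refine ⟨k, Subtype.ext ?_⟩
    change ρ w ^ p ^ k = 1
    rw [← map_pow]
    ext c
    change w ^ p ^ k * c * (w ^ p ^ k)⁻¹ = c
    rw [(hcomm _ hk c c.2).eq, mul_inv_cancel_right]
  -- A p-group acting on B fixes the identity, hence some other element as well. Minimality of B
  -- then gives C_B(W) = B.
  obtain ⟨c, hc, hc1⟩ := hρ.exists_fixed_point_of_prime_dvd_card_of_fixed_point B hpB (a := 1)
    (fun g => smul_one g)
  have hC : B ⊓ Subgroup.centralizer (W : Set X) = B := by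
    refine (hmin _ inferInstance inf_le_left).resolve_left fun h => hc1 (Subtype.ext ?_)
    have : (c : X) ∈ B ⊓ Subgroup.centralizer (W : Set X) := by
      refine ⟨c.2, Subgroup.mem_centralizer_iff.2 fun w hw => ?_⟩
      have h1 := congrArg Subtype.val (hc ⟨ρ w, Subgroup.mem_map_of_mem ρ hw⟩)
      exact mul_inv_eq_iff_eq_mul.1 h1
    rw [h] at this
    exact (Subgroup.mem_bot.1 this).symm
  exact Subgroup.mem_centralizer_iff.1 (inf_eq_left.1 hC hb) w hw

variable {G : Type u} [Group G] {F : GroupClass.{u}}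

/-- In X = (H/K) ⋊ (G/C_G(H/K)) the factor H/K is a minimal normal subgroup, so O_{p',p}(X)
centralizes it. A power of g landing in that radical therefore lies in C_G(H/K). -/
theorem powInto_ker_factorAction {p : ℕ} (hp : p.Prime) {S : Submonoid ℕ} {H K : Subgroup G}
    [H.Normal] [K.Normal] (hchief : IsChiefFactor H K) (hc : IsCentralFactor F H K)
    (hpH : p ∣ Nat.card (factor H K))
    (hF : ∀ (Y : Type u) [Group Y] [Finite Y], F.Mem Y → PowInto S ⊤ (pNilpotentRadical p Y)) :
    PowInto S ⊤ (factorAction H K).ker := by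
  let X := SemidirectProduct (factor H K) (G ⧸ (factorAction H K).ker)
    (QuotientGroup.kerLift (factorAction H K))
  have hX : Finite X := F.finite_of_mem X hc
  let inl : factor H K →* X := SemidirectProduct.inl
  let inr : G ⧸ (factorAction H K).ker →* X := SemidirectProduct.inr
  have hconj : ∀ (g : G) (x : factor H K),
      inr (g : G ⧸ (factorAction H K).ker) * inl x * (inr (g : G ⧸ (factorAction H K).ker))⁻¹ =
        inl (factorAction H K g x) := fun g x => by
    have h := SemidirectProduct.inl_aut (φ := QuotientGroup.kerLift (factorAction H K))
      (g : G ⧸ (factorAction H K).ker) x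
    rw [map_inv] at h
    exact h.symm
  have hinl : Function.Injective inl := SemidirectProduct.inl_injective
  have hBn : inl.range.Normal := by
    have : inl.range = (SemidirectProduct.rightHom : X →* _).ker :=
      SemidirectProduct.range_inl_eq_ker_rightHom
    rw [this]
    infer_instance
  have hmin : ∀ L : Subgroup X, L.Normal → L ≤ inl.range → L = ⊥ ∨ L = inl.range := by
    intro L hL hLB
    -- The preimage of L in G is normal and lies between K and H, so the chief factor condition
    -- applies to it.
    let L₀ : Subgroup G :=
      ((L.comap inl).map (factor H K).subtype).comap (QuotientGroup.mk' K)
    have hL₀ : ∀ g : G, g ∈ L₀ ↔ ∃ hg : (g : G ⧸ K) ∈ factor H K, inl ⟨g, hg⟩ ∈ L := by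
      intro g
      constructor
      · rintro ⟨x, hx, hxg⟩
        have hxg' : (x : G ⧸ K) = g := hxg
        exact ⟨hxg' ▸ x.2, by rwa [show (⟨g, hxg' ▸ x.2⟩ : factor H K) = x from Subtype.ext hxg'.symm]⟩
      · rintro ⟨hg, h⟩
        exact ⟨_, h, rfl⟩
    have hL₀n : L₀.Normal := by
      refine ⟨fun x hx g => ?_⟩
      obtain ⟨hxH, hx⟩ := (hL₀ x).1 hx
      have h1 := hL.conj_mem _ hx (inr (g : G ⧸ (factorAction H K).ker))
      rw [hconj] at h1
      exact ⟨_, h1, rfl⟩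
    have hKL : K ≤ L₀ := fun x hx => by
      refine ⟨1, one_mem _, ?_⟩
      exact ((QuotientGroup.eq_one_iff x).2 hx).symm
    have hfac : ∀ g : G, (g : G ⧸ K) ∈ factor H K → g ∈ H := by
      rintro g ⟨h, hh, hhg⟩
      have h1 : h⁻¹ * g ∈ K := QuotientGroup.eq.1 hhg
      simpa using mul_mem hh (hchief.2.2.1.le h1)
    have hLH : L₀ ≤ H := fun x hx => hfac x ((hL₀ x).1 hx).1
    rcases hchief.2.2.2 L₀ hL₀n hKL hLH with h | h
    · left
      rw [eq_bot_iff]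
      intro y hy
      obtain ⟨⟨_, g, hg, rfl⟩, rfl⟩ := hLB hy
      have h1 : g ∈ L₀ := ⟨_, hy, rfl⟩
      rw [h] at h1
      have h2 : (⟨(QuotientGroup.mk' K) g, Subgroup.mem_map_of_mem _ hg⟩ : factor H K) = 1 :=
        Subtype.ext ((QuotientGroup.eq_one_iff g).2 h1)
      rw [Subgroup.mem_bot]
      exact (congrArg inl h2).trans (map_one inl)
    · right
      refine le_antisymm hLB ?_
      rintro _ ⟨⟨_, g, hg, rfl⟩, rfl⟩
      have h1 : g ∈ L₀ := h ▸ hg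
      exact ((hL₀ g).1 h1).2
  have hcard : p ∣ Nat.card inl.range := by
    rwa [← Nat.card_congr (MonoidHom.ofInjective hinl).toEquiv]
  intro g _
  obtain ⟨m, hm, hgm⟩ := hF X hc (inr (g : G ⧸ (factorAction H K).ker)) trivial
  refine ⟨m, hm, ?_⟩
  rw [MonoidHom.mem_ker]
  refine MulEquiv.ext fun x => hinl ?_
  rw [← map_pow, ← QuotientGroup.mk_pow] at hgm
  rw [← hconj, (commute_of_mem_pNilpotentRadical hp hmin hcard hgm ⟨x, rfl⟩).eq,
    mul_inv_cancel_right]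
  rfl

/-- D shrinks down the series while staying p-nilpotent modulo the current term. If p divides |H/K|
it is cut by C_G(H/K); otherwise H/K is absorbed into the p'-part. At the bottom D lies in
O_{p',p}(G). -/
theorem powInto_pNilpotentRadical_of_centralSeries [Finite G] {p : ℕ} (hp : p.Prime)
    {S : Submonoid ℕ}
    (hF : ∀ (Y : Type u) [Group Y] [Finite Y], F.Mem Y → PowInto S ⊤ (pNilpotentRadical p Y))
    {M : Subgroup G} (hM : CentralSeries F M) {D : Subgroup G} (hDn : D.Normal)
    (hDM : PNilpotentMod p D M) (hD : PowInto S ⊤ D) :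
    PowInto S ⊤ (pNilpotentRadical p G) := by
  induction hM generalizing D with
  | bot => exact hD.mono le_rfl (hDM.le_pNilpotentRadical hp hDn)
  | @step H K _ _ _ hchief hc ih =>
    by_cases hpH : p ∣ Nat.card (factor H K)
    · have hker := powInto_ker_factorAction hp hchief hc hpH hF
      refine ih (D := D ⊓ (factorAction H K).ker) inferInstance ?_ fun g hg => ?_
      · exact hDM.inf.of_centralizes hp fun d hd x hx => mem_ker_factorAction.1 hd.2 x hx
      · obtain ⟨m, hm, hgm⟩ := hD g hg
        obtain ⟨n, hn, hgn⟩ := hker g hg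
        exact ⟨m * n, mul_mem hm hn, by rw [pow_mul]; exact pow_mem hgm n,
          by rw [mul_comm, pow_mul]; exact pow_mem hgn m⟩
    · refine ih hDn (hDM.trans fun x hx => ⟨Nat.card (factor H K),
        ((Nat.Prime.coprime_iff_not_dvd hp).2 hpH).symm, ?_⟩) hD
      have h1 : (⟨(x : G ⧸ K), Subgroup.mem_map_of_mem (QuotientGroup.mk' K) hx⟩ : factor H K) ^
        Nat.card (factor H K) = 1 := pow_card_eq_one'
      rw [← QuotientGroup.eq_one_iff, QuotientGroup.mk_pow]
      exact congrArg Subtype.val h1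

/-- Passing from the quotient by a normal subgroup with a central series to the whole group. -/
theorem powInto_pNilpotentRadical_of_quotient [Finite G] {p : ℕ} (hp : p.Prime)
    {S : Submonoid ℕ}
    (hF : ∀ (Y : Type u) [Group Y] [Finite Y], F.Mem Y → PowInto S ⊤ (pNilpotentRadical p Y))
    {M : Subgroup G} [M.Normal] (hM : CentralSeries F M)
    (h : PowInto S ⊤ (pNilpotentRadical p (G ⧸ M))) :
    PowInto S ⊤ (pNilpotentRadical p G) := by
  obtain ⟨V, hVn, hVD, hV, hDV⟩ := pNilpotentMod_pNilpotentRadical (G := G ⧸ M) hp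
  have h1 := hV.comap (QuotientGroup.mk' M)
  rw [MonoidHom.comap_bot, QuotientGroup.ker_mk'] at h1
  exact powInto_pNilpotentRadical_of_centralSeries hp hF hM
    (D := (pNilpotentRadical p (G ⧸ M)).comap (QuotientGroup.mk' M)) inferInstance
    ⟨V.comap (QuotientGroup.mk' M), inferInstance, Subgroup.comap_mono hVD, h1, hDV.comap _⟩
    (h.comap (QuotientGroup.mk' M))

end Hawkes

/-! ### Hypercentral products: assembling the edges and vertices. -/

section Product

variable {G : Type u} [Group G]

theorem one_mem_listProduct {n : ℕ} (A : Fin n → Subgroup G) (l : List (Fin n)) :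
    (1 : G) ∈ listProduct A l := by
  induction l with
  | nil => exact Set.mem_one.2 rfl
  | cons i l ih =>
    rw [listProduct, List.map_cons, List.prod_cons]
    exact Set.mem_mul.2 ⟨1, one_mem _, 1, ih, one_mul 1⟩

theorem subset_listProduct {n : ℕ} (A : Fin n → Subgroup G) {l : List (Fin n)} {j : Fin n}
    (hj : j ∈ l) : (A j : Set G) ⊆ listProduct A l := by
  intro a ha
  induction l with
  | nil => simp at hj
  | cons i l ih =>
    rw [listProduct, List.map_cons, List.prod_cons]
    rcases List.mem_cons.1 hj with rfl | h
    · exact Set.mem_mul.2 ⟨a, ha, 1, one_mem_listProduct A l, mul_one a⟩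
    · exact Set.mem_mul.2 ⟨1, one_mem _, a, ih h, one_mul a⟩

theorem listProduct_subset_iSup {n : ℕ} (A : Fin n → Subgroup G) (l : List (Fin n)) :
    listProduct A l ⊆ (⨆ i, A i : Subgroup G) := by
  induction l with
  | nil =>
    intro a ha
    rw [Set.mem_one.1 ha]
    exact one_mem _
  | cons i l ih =>
    rw [listProduct, List.map_cons, List.prod_cons]
    rintro _ ⟨a, ha, b, hb, rfl⟩
    exact mul_mem (le_iSup A i ha) (ih hb)

variable {F : GroupClass.{u}} {n : ℕ} {A : Fin n → Subgroup G}

/-- Modulo a normal subgroup containing the hypercenter the factors commute elementwise, so that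
the quotient is an image of their direct product. -/
theorem IsHypercentralProduct.exists_surjective (hA : IsHypercentralProduct F A) {M : Subgroup G}
    [M.Normal] (hM : hypercenter G F ≤ M) :
    ∃ f : (∀ i, A i) →* G ⧸ M, Function.Surjective f := by
  let ϕ : ∀ i, A i →* G ⧸ M := fun i => (QuotientGroup.mk' M).comp (A i).subtype
  have hcomm : Pairwise fun i j => ∀ (x : A i) (y : A j), Commute (ϕ i x) (ϕ j y) := by
    intro i j hij x y
    have hy : (y : G) ∈ Subgroup.closure (listProduct A ((List.finRange n).filter (· ≠ i))) :=
      Subgroup.subset_closure (subset_listProduct A (by simpa using hij.symm) y.2)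
    have h1 := hM (hA.commutator_le i (Subgroup.commutator_mem_commutator x.2 hy))
    rw [← QuotientGroup.eq_one_iff] at h1
    exact commutatorElement_eq_one_iff_commute.1 h1
  refine ⟨MonoidHom.noncommPiCoprod ϕ hcomm, ?_⟩
  rw [← MonoidHom.range_eq_top, MonoidHom.noncommPiCoprod_range, eq_top_iff]
  have h1 : (⨆ i, A i) = ⊤ := top_le_iff.1 fun g _ =>
    listProduct_subset_iSup A _ (hA.product_eq ▸ Set.mem_univ g)
  rw [← MonoidHom.range_eq_top.2 (QuotientGroup.mk'_surjective M), MonoidHom.range_eq_map, ← h1,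
    Subgroup.map_iSup]
  refine iSup_mono fun i => ?_
  rintro _ ⟨a, ha, rfl⟩
  exact ⟨⟨a, ha⟩, rfl⟩

/-- A nontrivial action of a `q`-element on a `p`-subgroup of the product is visible in a factor
or in a member of the formation. -/
theorem IsHypercentralProduct.hasQAction [Finite G] (hA : IsHypercentralProduct F A)
    (hher : F.IsHereditary) {p q : ℕ} (hp : p.Prime) (hq : q.Prime) (hpq : p ≠ q)
    {R : Subgroup G} (hR : IsPGroup p R) (h : HasQAction q R) :
    (∃ i, ∃ P : Subgroup (A i), IsPGroup p P ∧ HasQAction q P ∧ (¬ p ∣ R.index → ¬ p ∣ P.index)) ∨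
      ∃ (Y : Type u) (_ : Group Y) (_ : Finite Y) (P : Sylow p Y),
        F.Mem Y ∧ HasQAction q (P : Subgroup Y) := by
  refine or_iff_not_imp_right.2 fun hF => ?_
  obtain ⟨M, hMc, hM⟩ := exists_centralSeries_ge_hypercenter (G := G) F
  have := hMc.normal
  obtain ⟨f, hf⟩ := hA.exists_surjective hM
  obtain ⟨x, hxN, ⟨k, hk⟩, hxC⟩ := h
  have hquot : HasQAction q (R.map (QuotientGroup.mk' M)) := by
    refine ⟨x, Subgroup.le_normalizer_map _ (Subgroup.mem_map_of_mem (QuotientGroup.mk' M) hxN),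
      ⟨k, by rw [← QuotientGroup.mk_pow, hk]; rfl⟩, fun hC => hxC ?_⟩
    -- If x centralized R modulo M, all commutators [x, R] would lie in M, and with no such action
    -- in F this forces x to centralize R.
    refine mem_centralizer_of_centralSeries hher hp hq hpq hMc hR hxN hk (fun r hr => ?_)
      fun Y _ _ P hY hP => hF ⟨Y, _, ‹_›, P, hY, hP⟩
    have h1 := Subgroup.mem_centralizer_iff.1 hC r (Subgroup.mem_map_of_mem (QuotientGroup.mk' M) hr)
    rw [← QuotientGroup.eq_one_iff, QuotientGroup.mk_mul, QuotientGroup.mk_inv, mul_inv_eq_one]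
    exact mul_inv_eq_iff_eq_mul.2 h1.symm
  obtain ⟨Q, hQ, hQq, hQi⟩ := exists_hasQAction_of_surjective hp hq hpq hf (hR.map _) hquot
  obtain ⟨i, hi⟩ := exists_hasQAction_of_pi hQq
  -- Images under surjections have indices dividing the original ones, so prime-to-p index passes
  -- from R to its image in G/M, then to Q and to its i-th projection.
  refine ⟨i, _, hQ.map _, hi, fun hRi h => hQi (fun h' => hRi ?_) ?_⟩
  · exact h'.trans (Subgroup.index_map_dvd R (QuotientGroup.mk'_surjective M))
  · exact h.trans (Subgroup.index_map_dvd Q (Function.surjective_eval i))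

theorem IsHypercentralProduct.sylowGraph_edge [Finite G] (hA : IsHypercentralProduct F A)
    (hher : F.IsHereditary) {e : ℕ × ℕ} (he : e ∈ (sylowGraph G).edges) :
    (∃ i, e ∈ (sylowGraph (A i)).edges) ∨ e ∈ (F.graph @sylowGraph.{u}).edges := by
  obtain ⟨p, q⟩ := e
  obtain ⟨hp, hq, hpq, P, hP⟩ := mem_sylowGraph_edges_iff.1 he
  have := Fact.mk hp
  rcases hA.hasQAction hher hp hq hpq P.2 hP with ⟨i, Q, hQ, hQq, hi⟩ | ⟨Y, _, _, Q, hY, hQ⟩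
  · exact Or.inl ⟨i, mem_sylowGraph_edges_iff.2
      ⟨hp, hq, hpq, hQ.toSylow (hi P.not_dvd_index), by rwa [IsPGroup.toSylow_coe]⟩⟩
  · exact Or.inr ⟨Y, _, hY, mem_sylowGraph_edges_iff.2 ⟨hp, hq, hpq, Q, hQ⟩⟩

theorem IsHypercentralProduct.nCriticalGraph_edge [Finite G] (hA : IsHypercentralProduct F A)
    (hher : F.IsHereditary) {e : ℕ × ℕ} (he : e ∈ (nCriticalGraph G).edges) :
    (∃ i, e ∈ (nCriticalGraph (A i)).edges) ∨ e ∈ (F.graph @nCriticalGraph.{u}).edges := by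
  obtain ⟨p, q⟩ := e
  obtain ⟨hp, hq, hpq, R, hR, hRq⟩ := mem_nCriticalGraph_edges_iff.1 he
  rcases hA.hasQAction hher hp hq hpq hR hRq with ⟨i, Q, hQ, hQq, -⟩ | ⟨Y, _, _, Q, hY, hQ⟩
  · exact Or.inl ⟨i, mem_nCriticalGraph_edges_iff.2 ⟨hp, hq, hpq, Q, hQ, hQq⟩⟩
  · exact Or.inr ⟨Y, _, hY, mem_nCriticalGraph_edges_iff.2 ⟨hp, hq, hpq, Q, Q.2, hQ⟩⟩

theorem IsHypercentralProduct.hawkesGraph_edge [Finite G] (hA : IsHypercentralProduct F A)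
    {e : ℕ × ℕ} (he : e ∈ (hawkesGraph G).edges) :
    (∃ i, e ∈ (hawkesGraph (A i)).edges) ∨ e ∈ (F.graph @hawkesGraph.{u}).edges := by
  obtain ⟨p, q⟩ := e
  obtain ⟨hp, hq, hG⟩ := mem_hawkesGraph_edges_iff.1 he
  by_contra! hcon
  obtain ⟨hAi, hF⟩ := hcon
  obtain ⟨M, hMc, hM⟩ := exists_centralSeries_ge_hypercenter (G := G) F
  have := hMc.normal
  obtain ⟨f, hf⟩ := hA.exists_surjective hM
  refine hG (powInto_pNilpotentRadical_of_quotient hp (fun Y _ _ hY => ?_) hMc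
    (powInto_pNilpotentRadical_of_surjective hp hf (powInto_pNilpotentRadical_pi hp fun i => ?_)))
  · by_contra h
    exact hF ⟨Y, _, hY, mem_hawkesGraph_edges_iff.2 ⟨hp, hq, h⟩⟩
  · by_contra h
    exact hAi i (mem_hawkesGraph_edges_iff.2 ⟨hp, hq, h⟩)

/-- Every prime divisor of `|G|` divides the order of a nilpotent group in the class. -/
theorem exists_mem_primeDivisors [Finite G] (hnil : F.ContainsNilpotent) {p : ℕ}
    (hp : p ∈ primeDivisors G) : ∃ (X : Type u) (_ : Group X), F.Mem X ∧ p ∈ primeDivisors X := by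
  have := Fact.mk hp.1
  let P : Sylow p G := default
  refine ⟨P, inferInstance, hnil P (IsPGroup.isNilpotent P.2), hp.1, ?_⟩
  exact P.dvd_card_of_dvd_card hp.2

/-- All vertices are supplied by Γ(F) through nilpotent groups, so only the edges depend on the
graph chosen. -/
theorem isSubgraph_of_edges [Finite G] {Γ : (X : Type u) → [Group X] → DirGraph}
    (hv : ∀ (X : Type u) [Group X], (Γ X).verts = primeDivisors X) (hnil : F.ContainsNilpotent)
    (he : ∀ e ∈ (Γ G).edges, (∃ i, e ∈ (Γ (A i)).edges) ∨ e ∈ (F.graph Γ).edges) :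
    (Γ G).IsSubgraph
      ((DirGraph.iUnion fun i => Γ (A i)).union ((F.graph Γ).restrict (primeDivisors G))) := by
  refine ⟨fun p hp => Or.inr ?_, fun e h => ?_⟩
  · rw [hv] at hp
    obtain ⟨X, _, hX, hpX⟩ := exists_mem_primeDivisors hnil hp
    exact ⟨⟨X, _, hX, by rwa [hv]⟩, hp⟩
  · rcases he e h with ⟨i, hi⟩ | hF
    · exact Or.inl (Set.mem_iUnion.2 ⟨i, hi⟩)
    · have h1 := (Γ G).edges_subset e h
      rw [hv] at h1
      exact Or.inr ⟨hF, h1⟩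

end Product

theorem mainTheorem3 (F : GroupClass.{u}) (hform : F.IsFormation) (hher : F.IsHereditary)
    (hnil : F.ContainsNilpotent)
    (Γ : (X : Type u) → [Group X] → DirGraph)
    (hΓ : Γ = @sylowGraph.{u} ∨ Γ = @nCriticalGraph.{u} ∨ Γ = @hawkesGraph.{u})
    (G : Type u) [Group G] [Finite G] (n : ℕ) (A : Fin n → Subgroup G)
    (hA : IsHypercentralProduct F A) :
    (Γ G).IsSubgraph
      ((DirGraph.iUnion fun i => Γ (A i)).union ((F.graph Γ).restrict (primeDivisors G))) := by
  rcases hΓ with rfl | rfl | rfl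
  · exact isSubgraph_of_edges (fun _ _ => rfl) hnil fun _ he => hA.sylowGraph_edge hher he
  · exact isSubgraph_of_edges (fun _ _ => rfl) hnil fun _ he => hA.nCriticalGraph_edge hher he
  · exact isSubgraph_of_edges (fun _ _ => rfl) hnil fun _ he => hA.hawkesGraph_edge he
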